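/- Let $p\ge 2$, $\gamma>0$, $\theta>1$, $\tau>1$ and $0<\nu\le 1$. There is a constant $C>0$ depending only on $p,\gamma,\theta,\tau,\nu$, and for every $\mu>0$ with $\gamma^{1/(p-1)}\theta^{2/p}\mu^{-1}<(\tau-1)/2$ there is $\varepsilon>0$ depending only on $p,\gamma,\theta,\tau,\nu,\mu$, such that the following holds. **Setting.** Let $X,Y$ be real Banach spaces and let $\Theta:X\to(-\infty,\infty]$ be proper, lower semi-continuous and $p$-convex, i.e. for some $C_0>0$ one has $\Theta(\lambda z+(1-\lambda)x)+C_0\lambda(1-\lambda)\|z-x\|^p\le\lambda\Theta(z)+(1-\lambda)\Theta(x)$ for all $x,z\in X$, $\lambda\in(0,1)$. For a function $\Psi:X\to(-\infty,\infty]$ put $D(\Psi)=\{\Psi<\infty\}$, $D_\xi\Psi(z,x)=\Psi(z)-\Psi(x)-\langle\xi,z-x\rangle$, $\partial\Psi(x)=\{\xi\in X^*: D_\xi\Psi(z,x)\ge 0\ \forall z\in X\}$ and $D(\partial\Psi)=\{x\in D(\Psi):\partial\Psi(x)\ne\emptyset\}$. Suppose that $\gamma$ satisfies $\|z-x\|\le\gamma[D_\xi\Theta(z,x)]^{1/p}$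 for all $z\in X$, $x\in D(\partial\Theta)$, $\xi\in\partial\Theta(x)$. Let $\alpha_n>0$ satisfy $1\le\alpha_n/\alpha_{n+1}\le\theta$ and $\alpha_n\to0$. Let $F:D(F)\subset X\to Y$ satisfy: (a) $D(F)$ is closed and convex, and $F(x^\dag)=y$ for some $x^\dag\in D(F)\cap D(\partial\Theta)$; (b) there is $\rho>0$ such that for each $x\in B_\rho(x^\dag)\cap D(F)$ there is a bounded linear operator $F'(x):X\to Y$ with $\lim_{t\searrow0}t^{-1}(F(x+t(z-x))-F(x))=F'(x)(z-x)$ for all $z\in B_\rho(x^\dag)\cap D(F)$, where $B_\rho(x^\dag)$ is the open ball; (c) $T:=F'(x^\dag)$ satisfies $\|T\|\le\alpha_0^{1/p}/\gamma$; (d) there are constants $K_0,K_1\ge0$ with $\|(F'(z)-F'(x))w\|\le K_0\|z-x\|\,\|F'(x)w\|+K_1\|F'(x)(z-x)\|\,\|w\|$ for all $w\in X$ and $x,z\in B_\rho(x^\dag)\cap D(F)$. Let $\Theta_F=\Theta$ on $D(F)$ and $\Theta_F=\infty$ off $D(F)$. Let $\xi_0\in X^*$ and $x_0=\nabla\Theta_F^*(\xi_0)$,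 where $\Theta_F^*(\xi)=\sup_x\{\langle\xi,x\rangle-\Theta_F(x)\}$ is the Fenchel conjugate, and let $\xi^\dag\in\partial\Theta_F(x^\dag)$ realize the distance from $\xi_0$ to $\partial\Theta_F(x^\dag)$. Assume $$\Big(\tfrac{p}{p-1}\gamma\mu+2\gamma^{\frac p{p-1}}\Big)\|\xi_0-\xi^\dag\|^{\frac1{p-1}}<\rho,\qquad (K_0+K_1)\|\xi_0-\xi^\dag\|^{\frac1{p-1}}\le\varepsilon,$$ and, for some $\beta\ge0$, the variational source condition $$\langle\xi_0-\xi^\dag,x-x^\dag\rangle\le\beta\,[D_{\xi^\dag}\Theta_F(x,x^\dag)]^{\frac{1-\nu}p}\,\|T(x-x^\dag)\|^\nu\qquad\text{for all }x\in X\text{ with }\Theta_F(x)<\infty .$$ **Method.** Let $\delta>0$ and $y^\delta\in Y$ with $\|y^\delta-y\|\le\delta$. Put $x_0^\delta=x_0$ and, as long as $x_n^\delta\in B_\rho(x^\dag)\cap D(F)$ (where $F'(x_n^\delta)$ is given), let $x_{n+1}^\delta$ be the minimizer over $X$ of $$x\mapsto\|y^\delta-F(x_n^\delta)-F'(x_n^\delta)(x-x_n^\delta)\|^p+\alpha_nD_{\xi_0}\Theta_F(x,x_0).$$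 Write $r_n=\|F(x_n^\delta)-y^\delta\|$. Let $n_\delta=0$ if $r_0\le\tau\delta$; otherwise let $n_\delta$ be either the first integer $n\ge1$ with $\tfrac12(r_n+r_{n-1})\le\tau\delta$ (averaged rule), or the first integer $n\ge2$ with $\max\{r_n,r_{n-1}\}\le\tau\delta$ (maximum rule). **Conclusion.** For each of the two rules the integer $n_\delta$ exists and is unique, and $$D_{\xi^\dag}\Theta_F(x_{n_\delta}^\delta,x^\dag)\le C\beta^{\frac p{p-1+\nu}}\delta^{\frac{p\nu}{p-1+\nu}},\qquad \|x_{n_\delta}^\delta-x^\dag\|\le C\beta^{\frac1{p-1+\nu}}\delta^{\frac\nu{p-1+\nu}}.$$ -/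

import Mathlib

open Filter Topology

namespace IRGN

noncomputable section

section Convex

variable {X : Type*} [NormedAddCommGroup X] [NormedSpace ℝ X]

/-- The effective domain `D(Θ)`. -/
def effDomain (Θ : X → EReal) : Set X := {x | Θ x ≠ ⊤}

/-- `Θ` takes values in `(-∞, ∞]` and is not identically `∞`. -/
def IsProper (Θ : X → EReal) : Prop := (∀ x, Θ x ≠ ⊥) ∧ (effDomain Θ).Nonempty

/-- The expression `D_ξ Θ(z, x) = Θ(z) - Θ(x) - ⟨ξ, z - x⟩` (the Bregman distance if
`ξ` is a subgradient of `Θ` at `x`). -/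
def bregman (Θ : X → EReal) (ξ : StrongDual ℝ X) (z x : X) : EReal :=
  Θ z - Θ x - ((ξ (z - x) : ℝ) : EReal)

/-- The subdifferential `∂Θ(x)`. It is empty outside of the effective domain when `Θ` is proper. -/
def subdiff (Θ : X → EReal) (x : X) : Set (StrongDual ℝ X) :=
  {ξ | ∀ z, 0 ≤ bregman Θ ξ z x}

/-- The domain `D(∂Θ)` of the subdifferential. -/
def subdiffDomain (Θ : X → EReal) : Set X :=
  {x | x ∈ effDomain Θ ∧ (subdiff Θ x).Nonempty}

/-- `p`-convexity of a function with values in `(-∞, ∞]`. -/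
def IsPConvex (p : ℝ) (Θ : X → EReal) : Prop :=
  ∃ C₀ : ℝ, 0 < C₀ ∧ ∀ (x z : X) (l : ℝ), 0 < l → l < 1 →
    Θ (l • z + (1 - l) • x) + ((C₀ * l * (1 - l) * ‖z - x‖ ^ p : ℝ) : EReal)
      ≤ (l : EReal) * Θ z + ((1 - l : ℝ) : EReal) * Θ x

/-- The constant `γ` satisfies `‖z - x‖ ≤ γ [D_ξ Θ(z, x)]^{1/p}` for all `z`, all `x ∈ D(∂Θ)`
and all `ξ ∈ ∂Θ(x)`. The right-hand side is `∞`, and there is nothing to require, if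
`Θ(z) = ∞`. -/
def PConvexBound (p γ : ℝ) (Θ : X → EReal) : Prop :=
  ∀ x ∈ subdiffDomain Θ, ∀ ξ ∈ subdiff Θ x, ∀ z ∈ effDomain Θ,
    ‖z - x‖ ≤ γ * (bregman Θ ξ z x).toReal ^ (1 / p)

/-- The function `Θ_F = Θ + χ_{D(F)}`, with `χ_{D(F)}` equal to `0` on `D(F)` and to `∞` off
`D(F)`. -/
def restrictTo (Θ : X → EReal) (DF : Set X) : X → EReal :=
  open Classical in fun x => Θ x + (if x ∈ DF then 0 else ⊤)

/-- The Fenchel conjugate `Θ*` on the dual space. -/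
def fenchelConj (Θ : X → EReal) (ξ : StrongDual ℝ X) : EReal :=
  ⨆ x : X, ((ξ x : ℝ) : EReal) - Θ x

/-- The function `Φ` on the dual space is finite near `ξ` and Fréchet differentiable at `ξ`, and
its derivative is the evaluation at `x`; that is, `x = ∇Φ(ξ)`. -/
def IsDualGradientAt (Φ : StrongDual ℝ X → EReal) (ξ : StrongDual ℝ X) (x : X) : Prop :=
  (∀ᶠ η in 𝓝 ξ, Φ η ≠ ⊥ ∧ Φ η ≠ ⊤) ∧
    HasFDerivAt (fun η => (Φ η).toReal) (NormedSpace.inclusionInDoubleDual ℝ X x) ξ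

end Convex

section Method

variable {X Y : Type*} [NormedAddCommGroup X] [NormedSpace ℝ X]
  [NormedAddCommGroup Y] [NormedSpace ℝ Y]

/-- The conditions on the sequence of regularization parameters. -/
def IsParamSeq (θ : ℝ) (α : ℕ → ℝ) : Prop :=
  (∀ n, 0 < α n) ∧ (∀ n, 1 ≤ α n / α (n + 1) ∧ α n / α (n + 1) ≤ θ) ∧
    Tendsto α atTop (𝓝 0)

/-- The standing assumption on the operator `F : D(F) ⊆ X → Y` and on the solution `xd` of
`F(x) = y`. The values of `F` off `D(F)` and of `F'` off `B_ρ(xd) ∩ D(F)` play no role. -/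
structure OperatorAssumption (p γ : ℝ) (Θ : X → EReal) (α₀ : ℝ) (DF : Set X) (F : X → Y) (y : Y)
    (xd : X) (ρ : ℝ) (F' : X → X →L[ℝ] Y) (K₀ K₁ : ℝ) : Prop where
  isClosed_domain : IsClosed DF
  convex_domain : Convex ℝ DF
  sol_mem_domain : xd ∈ DF
  sol_mem_subdiffDomain : xd ∈ subdiffDomain Θ
  sol_eq : F xd = y
  radius_pos : 0 < ρ
  derivative : ∀ x ∈ Metric.ball xd ρ ∩ DF, ∀ z ∈ Metric.ball xd ρ ∩ DF,
    Tendsto (fun t : ℝ => t⁻¹ • (F (x + t • (z - x)) - F x)) (𝓝[>] 0) (𝓝 (F' x (z - x)))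
  scaling : ‖F' xd‖ ≤ α₀ ^ (1 / p) / γ
  K₀_nonneg : 0 ≤ K₀
  K₁_nonneg : 0 ≤ K₁
  nonlinearity : ∀ x ∈ Metric.ball xd ρ ∩ DF, ∀ z ∈ Metric.ball xd ρ ∩ DF, ∀ w : X,
    ‖(F' z - F' x) w‖ ≤ K₀ * ‖z - x‖ * ‖F' x w‖ + K₁ * ‖F' x (z - x)‖ * ‖w‖

/-- The functional minimized in one step: with current iterate `u`, regularization parameter `a`,
penalty `Ψ` (which is `Θ_F`) and initial data `ξ₀`, `x₀`, it is
`‖yδ - F(u) - F'(u)(x - u)‖^p + a D_{ξ₀} Ψ(x, x₀)`. -/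
def stepFunctional (p : ℝ) (Ψ : X → EReal) (F : X → Y) (F' : X → X →L[ℝ] Y) (yδ : Y)
    (ξ₀ : StrongDual ℝ X) (x₀ : X) (a : ℝ) (u x : X) : EReal :=
  ((‖yδ - F u - F' u (x - u)‖ ^ p : ℝ) : EReal) + (a : EReal) * bregman Ψ ξ₀ x x₀

/-- The sequence `x` is generated by the iteratively regularized Gauss--Newton method started at
`x₀`: as long as the current iterate lies in `B_ρ(xd) ∩ D(F)`, where the derivative `F'` is given,
the next iterate minimizes the step functional over the whole space. -/
def IsIRGN (p : ℝ) (Ψ : X → EReal) (DF : Set X) (F : X → Y) (xd : X) (ρ : ℝ)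
    (F' : X → X →L[ℝ] Y) (α : ℕ → ℝ) (yδ : Y) (ξ₀ : StrongDual ℝ X) (x₀ : X) (x : ℕ → X) : Prop :=
  x 0 = x₀ ∧ ∀ n, x n ∈ Metric.ball xd ρ ∩ DF →
    IsMinOn (stepFunctional p Ψ F F' yδ ξ₀ x₀ (α n) (x n)) Set.univ (x (n + 1))

/-- The variational source condition. Only points `x` with `Θ_F(x) < ∞` are tested (here `Ψ` is
`Θ_F`); this is implied by the condition for all `x`, whatever meaning is given to it
where the Bregman distance is infinite. -/
def SourceCondition (p ν β : ℝ) (Ψ : X → EReal) (ξ₀ ξd : StrongDual ℝ X) (xd : X)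
    (T : X →L[ℝ] Y) : Prop :=
  ∀ x ∈ effDomain Ψ,
    (ξ₀ - ξd) (x - xd)
      ≤ β * (bregman Ψ ξd x xd).toReal ^ ((1 - ν) / p) * ‖T (x - xd)‖ ^ ν

/-- The averaged discrepancy rule selects `n`; here `r k = ‖F(x_k) - yδ‖`. -/
def AverageRule (τ δ : ℝ) (r : ℕ → ℝ) (n : ℕ) : Prop :=
  (r 0 ≤ τ * δ ∧ n = 0) ∨
    (τ * δ < r 0 ∧ IsLeast {m : ℕ | 1 ≤ m ∧ 1 / 2 * (r m + r (m - 1)) ≤ τ * δ} n)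

/-- The maximum discrepancy rule selects `n`; here `r k = ‖F(x_k) - yδ‖`. -/
def MaxRule (τ δ : ℝ) (r : ℕ → ℝ) (n : ℕ) : Prop :=
  (r 0 ≤ τ * δ ∧ n = 0) ∨
    (τ * δ < r 0 ∧ IsLeast {m : ℕ | 2 ≤ m ∧ max (r m) (r (m - 1)) ≤ τ * δ} n)

end Method

end

end IRGN

/-! Everything reduces to a recursion between scalars: the `p`-th root d_n of the Bregman distance
to x†, N_n = ‖T(x_n − x†)‖, the discrepancy r_n, and a_n = α_n^(1/p). Comparing the minimizer of a
step with x† gives Q^p + a^p d^p ≤ R^p + a^p ⟨ξ₀ − ξ†, x_{n+1} − x†⟩, with Q and R the linearized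
residuals of x_{n+1} and of x†. By the nonlinearity condition, R exceeds δ by at most a small
multiple of N_n. The pairing is then estimated in two ways.

The crude estimate uses only the dual norm: the pairing is at most (gS)^(p−1) d with g = γ^(1/(p−1))
and S = ‖ξ₀ − ξ†‖^(1/(p−1)). As long as δ ≤ μ a_n S it keeps the iterates in the ball and N_n of
order a_n S (`apriori_bounds`). At the first index k with μ a_k S ≤ δ the condition on μ pushes r_k
and r_{k−1} below τδ, or r_0 if k < 2, so both rules stop no later than k
(`exists_index_discrepancy_le`).

The fine estimate uses the source condition. With q = p − 1 + ν the pairing is at most w^q d^(1−ν),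
where w = β^(1/q) N^(ν/q). Young's inequality then yields r_n ≤ (1 + τ)/2 · δ + J ω_n with ω_n =
a_n^(q/(p−1)) β^(1/(p−1)). If a rule stops at m + 1 ≥ 1, a discrepancy above τδ occurred at m or m −
1, so δ is bounded by a multiple of ω_m, that is, δ/a_m by a multiple of β^(1/q) δ^(ν/q). Both r_m
and r_{m+1} are at most 2τδ, which bounds N_m and N_{m+1} by a multiple of δ. Inserting this into
d_{m+1} ≤ 2R_m/a_m + 2w gives the rate (`exists_rate`).

One convex-analytic point remains: a subgradient of Θ_F need not be one of Θ, so the bound with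
constant γ must be transferred to Θ_F (`restrict_bound`). -/

namespace IRGN

/-! ### Scalar consequences of the minimality inequality. -/

section RealInequalities

lemma rpow_mul_rpow_le {p e w d t : ℝ} (he : 0 ≤ e) (hep : e ≤ p) (hw : 0 ≤ w) (hd : 0 ≤ d)
    (hwt : w ≤ t) (hdt : d ≤ t) : w ^ (p - e) * d ^ e ≤ t ^ p := by
  have ht : 0 ≤ t := hw.trans hwt
  calc w ^ (p - e) * d ^ e ≤ t ^ (p - e) * t ^ e := by
        have := sub_nonneg.2 hep
        gcongr
    _ = t ^ p := by
        rw [← Real.rpow_add_of_nonneg ht (sub_nonneg.2 hep) he, sub_add_cancel]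

lemma le_of_rpow_le_mul_rpow {p e w d : ℝ} (hep : e < p) (hw : 0 ≤ w)
    (h : d ^ p ≤ w ^ (p - e) * d ^ e) : d ≤ w := by
  by_contra! hlt
  have hd0 : 0 < d := hw.trans_lt hlt
  have h1 : w ^ (p - e) < d ^ (p - e) := Real.rpow_lt_rpow hw hlt (sub_pos.2 hep)
  have h2 : w ^ (p - e) * d ^ e < d ^ (p - e) * d ^ e :=
    mul_lt_mul_of_pos_right h1 (Real.rpow_pos_of_pos hd0 _)
  rw [← Real.rpow_add hd0, sub_add_cancel] at h2
  exact absurd h (not_le.2 h2)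

/-- The residual bound contained in the minimality inequality of one step. -/
lemma resid_le_of_step {p e a w d Q R : ℝ} (hp : 1 ≤ p) (he : 0 ≤ e) (hep : e ≤ p)
    (ha : 0 < a) (hw : 0 ≤ w) (hd : 0 ≤ d) (hR : 0 ≤ R)
    (h : Q ^ p + a ^ p * d ^ p ≤ R ^ p + a ^ p * (w ^ (p - e) * d ^ e)) : Q ≤ R + a * w := by
  have hp0 : 0 < p := by linarith
  by_contra! hQ
  have haw : 0 ≤ a * w := by positivity
  have h1 : (R + a * w) ^ p < Q ^ p := Real.rpow_lt_rpow (by positivity) hQ hp0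
  have h2 := Real.add_rpow_le_rpow_add hR haw hp
  rw [Real.mul_rpow ha.le hw] at h2
  have hap : 0 < a ^ p := Real.rpow_pos_of_pos ha p
  have h3 : w ^ (p - e) * d ^ e ≤ w ^ p + d ^ p := by
    rcases le_total w d with hwd | hwd
    · exact (rpow_mul_rpow_le he hep hw hd hwd le_rfl).trans
        (le_add_of_nonneg_left (Real.rpow_nonneg hw _))
    · exact (rpow_mul_rpow_le he hep hw hd le_rfl hwd).trans
        (le_add_of_nonneg_right (Real.rpow_nonneg hd _))
  have h4 := mul_le_mul_of_nonneg_left h3 hap.le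
  linarith

/-- The distance bound contained in the minimality inequality of one step, far from the
solution. -/
lemma rpow_le_of_step {p e a w d Q R : ℝ} (hep : e < p)
    (ha : 0 < a) (hw : 0 ≤ w) (hQ : 0 ≤ Q) (hR : 0 ≤ R) (hwd : 2 * w < d)
    (h : Q ^ p + a ^ p * d ^ p ≤ R ^ p + a ^ p * (w ^ (p - e) * d ^ e)) :
    (1 - 2 ^ (-(p - e))) * d ^ p ≤ (R / a) ^ p := by
  have hd0 : 0 < d := by linarith
  have hap : 0 < a ^ p := Real.rpow_pos_of_pos ha p
  -- Since w < d/2, the mixed term is only the fraction 2^(−(p−e)) of d^p and can be absorbed on the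
  -- left.
  have h1 : w ^ (p - e) ≤ (2⁻¹ * d) ^ (p - e) :=
    Real.rpow_le_rpow hw (by linarith) (sub_pos.2 hep).le
  have h2 : w ^ (p - e) * d ^ e ≤ 2 ^ (-(p - e)) * d ^ p := by
    calc w ^ (p - e) * d ^ e ≤ (2⁻¹ * d) ^ (p - e) * d ^ e := by gcongr
      _ = 2 ^ (-(p - e)) * (d ^ (p - e) * d ^ e) := by
          rw [Real.mul_rpow (by norm_num) hd0.le, Real.inv_rpow (by norm_num),
            Real.rpow_neg (by norm_num), mul_assoc]
      _ = _ := by rw [← Real.rpow_add hd0, sub_add_cancel]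
  have h3 := mul_le_mul_of_nonneg_left h2 hap.le
  have hQp := Real.rpow_nonneg hQ p
  rw [Real.div_rpow hR ha.le, le_div_iff₀ hap]
  linarith

/-- If d > 2w, the gap p − e ≥ 1 leaves at least half of d^p after absorption, so d^p ≤ 2(R/a)^p ≤
(2R/a)^p. -/
lemma dist_le_of_step {p e a w d Q R : ℝ} (hp : 1 ≤ p) (hep : e + 1 ≤ p)
    (ha : 0 < a) (hw : 0 ≤ w) (hd : 0 ≤ d) (hQ : 0 ≤ Q) (hR : 0 ≤ R)
    (h : Q ^ p + a ^ p * d ^ p ≤ R ^ p + a ^ p * (w ^ (p - e) * d ^ e)) :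
    d ≤ 2 * (R / a) + 2 * w := by
  have hRa : 0 ≤ R / a := by positivity
  by_contra! hlt
  have h1 := rpow_le_of_step (by linarith) ha hw hQ hR (by linarith) h
  have h2 : (2 : ℝ) ^ (-(p - e)) ≤ 1 / 2 := by
    calc (2 : ℝ) ^ (-(p - e)) ≤ 2 ^ (-1 : ℝ) :=
          Real.rpow_le_rpow_of_exponent_le (by norm_num) (by linarith)
      _ = 1 / 2 := by rw [Real.rpow_neg_one]; norm_num
  have h3 : (2 * (R / a)) ^ p < d ^ p :=
    Real.rpow_lt_rpow (by positivity) (by linarith) (by linarith)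
  rw [Real.mul_rpow (by norm_num) hRa] at h3
  have h4 : (2 : ℝ) ≤ 2 ^ p := by
    simpa using Real.rpow_le_rpow_of_exponent_le (x := 2) (by norm_num) hp
  have h5 := Real.rpow_nonneg hRa p
  have h6 := Real.rpow_nonneg hd p
  nlinarith

/-- The sharper constant p/(p − 1) matches the radius in the closeness condition. Bernoulli gives
2^(p−1) ≥ p, so absorption leaves the fraction 1 − 1/p of d^p. The square root in the bound for R is
slack, later spent on the nonlinearity. -/
lemma le_of_step_linear {p a w d Q R m : ℝ} (hp : 2 ≤ p)
    (ha : 0 < a) (hw : 0 ≤ w) (hQ : 0 ≤ Q) (hR : 0 ≤ R)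
    (hm : R ≤ a * (Real.sqrt (p / (p - 1)) * m)) (hm0 : 0 ≤ m)
    (h : Q ^ p + a ^ p * d ^ p ≤ R ^ p + a ^ p * (w ^ (p - 1) * d)) :
    d ≤ p / (p - 1) * m + 2 * w := by
  by_contra! hlt
  have hp1 : 0 < p - 1 := by linarith
  set c := p / (p - 1) with hc
  have hc1 : 1 ≤ c := by rw [hc, le_div_iff₀ hp1]; linarith
  have hc0 : 0 < c := by linarith
  have hcm : 0 ≤ c * m := by positivity
  have hd : 0 ≤ d := by linarith
  have h1 := rpow_le_of_step (p := p) (e := 1) (w := w) (d := d) (by linarith) ha hw hQ hR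
    (by linarith) (by simpa using h)
  have h2 : (2 : ℝ) ^ (-(p - 1)) ≤ 1 / p := by
    have hb := one_add_mul_self_le_rpow_one_add (s := 1) (by norm_num) (p := p - 1) (by linarith)
    rw [Real.rpow_neg (by norm_num), ← one_div]
    apply one_div_le_one_div_of_le (by linarith)
    norm_num at hb ⊢
    linarith
  have h3 : 1 / c * d ^ p ≤ (R / a) ^ p := by
    refine le_trans ?_ h1
    have : 1 / c = 1 - 1 / p := by rw [hc]; field_simp
    rw [this]
    gcongr
  have h4 : (c * m) ^ p < d ^ p := Real.rpow_lt_rpow (by positivity) (by linarith) (by linarith)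
  have h5 : (R / a) ^ p ≤ (Real.sqrt c * m) ^ p := by
    apply Real.rpow_le_rpow (by positivity) _ (by linarith)
    rw [div_le_iff₀ ha]; linarith
  rw [Real.mul_rpow hc0.le hm0] at h4
  rw [Real.mul_rpow (Real.sqrt_nonneg _) hm0] at h5
  -- The exponent p/2 + 1 is at most p because p ≥ 2.
  have h6 : Real.sqrt c ^ p * c ≤ c ^ p := by
    rw [Real.sqrt_eq_rpow, ← Real.rpow_mul hc0.le]
    calc c ^ (1 / 2 * p) * c = c ^ (1 / 2 * p + 1) := by rw [Real.rpow_add_one hc0.ne']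
      _ ≤ c ^ p := Real.rpow_le_rpow_of_exponent_le hc1 (by linarith)
  have h7 : d ^ p ≤ c * (Real.sqrt c ^ p * m ^ p) := by
    have := h3.trans h5
    rw [one_div, inv_mul_le_iff₀ hc0] at this
    exact this
  have h8 := mul_le_mul_of_nonneg_right h6 (Real.rpow_nonneg hm0 p)
  linarith

/-- Young's inequality with an arbitrarily small coefficient. -/
lemma exists_rpow_mul_rpow_le {κ σ : ℝ} (hκ₀ : 0 ≤ κ) (hκ₁ : κ < 1) (hσ : 0 < σ) :
    ∃ H : ℝ, 0 < H ∧ ∀ ω N : ℝ, 0 ≤ ω → 0 ≤ N → ω ^ (1 - κ) * N ^ κ ≤ σ * N + H * ω := by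
  have h1 : 0 < 1 - κ := by linarith
  -- H solves H^(1−κ) σ^κ = 1, so weighted AM–GM for Hω and σN has no leftover factor.
  refine ⟨σ ^ (-(κ / (1 - κ))), Real.rpow_pos_of_pos hσ _, fun ω N hω hN => ?_⟩
  set H := σ ^ (-(κ / (1 - κ))) with hH
  have hH0 : 0 < H := Real.rpow_pos_of_pos hσ _
  have h2 : H ^ (1 - κ) * σ ^ κ = 1 := by
    rw [hH, ← Real.rpow_mul hσ.le, ← Real.rpow_add hσ]
    have : -(κ / (1 - κ)) * (1 - κ) + κ = 0 := by field_simp; ring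
    rw [this, Real.rpow_zero]
  have h3 := Real.geom_mean_le_arith_mean2_weighted h1.le hκ₀ (mul_nonneg hH0.le hω)
    (mul_nonneg hσ.le hN) (by ring)
  rw [Real.mul_rpow hH0.le hω, Real.mul_rpow hσ.le hN] at h3
  have h4 : ω ^ (1 - κ) * N ^ κ
      = H ^ (1 - κ) * ω ^ (1 - κ) * (σ ^ κ * N ^ κ) := by
    calc ω ^ (1 - κ) * N ^ κ = H ^ (1 - κ) * σ ^ κ * (ω ^ (1 - κ) * N ^ κ) := by
          rw [h2, one_mul]
      _ = _ := by ring
  rw [h4]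
  have h5 : 0 ≤ H * ω := by positivity
  have h6 : 0 ≤ σ * N := by positivity
  nlinarith

end RealInequalities

/-! ### The scalar recursion, and termination by the crude estimate. -/

section Recursion

/-- The scalar inequalities satisfied by the iterates `x n` of the Gauss--Newton method: `E n` is
the distance to the solution, `d n` the `p`-th root of the Bregman distance, `N n` the norm of the
linearized image of the error, `r n` the discrepancy, `Q (n + 1)` the linearized residual of the
minimizer, `R n` that of the solution, `I n` the pairing in the source condition and `a n` the
`p`-th root of the regularization parameter. `G n` says that the penalty is finite at `x n`. -/
structure IterationEstimates (p ν γ b K₀ K₁ β ρ δ : ℝ) (a E d N r Q R I : ℕ → ℝ)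
    (G : ℕ → Prop) : Prop where
  E_nonneg : ∀ n, 0 ≤ E n
  d_nonneg : ∀ n, 0 ≤ d n
  N_nonneg : ∀ n, 0 ≤ N n
  Q_nonneg : ∀ n, 0 ≤ Q n
  R_nonneg : ∀ n, 0 ≤ R n
  init_mem : G 0
  init_le : d 0 ^ p ≤ I 0
  init_image_le : N 0 ≤ a 0 / γ * E 0
  dist_le : ∀ n, G n → E n ≤ γ * d n
  pairing_le : ∀ n, G n → I n ≤ b ^ (p - 1) * d n
  source_le : ∀ n, G n → I n ≤ β * d n ^ (1 - ν) * N n ^ ν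
  step_mem : ∀ n, G n → E n < ρ → G (n + 1)
  step_le : ∀ n, G n → E n < ρ →
    Q (n + 1) ^ p + a n ^ p * d (n + 1) ^ p ≤ R n ^ p + a n ^ p * I (n + 1)
  solution_resid_le : ∀ n, G n → E n < ρ →
    R n ≤ δ + (K₀ + K₁) * E n * (1 + (K₀ + K₁) * E n) * N n
  discrepancy_le : ∀ n, G n → E n < ρ → r n ≤ δ + (1 + (K₀ + K₁) * E n) * N n
  image_le : ∀ n, G n → E n < ρ → N n ≤ r n + δ + (K₀ + K₁) * E n * N n
  image_succ_le : ∀ n, G n → E n < ρ → E (n + 1) < ρ →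
    N (n + 1) ≤ Q (n + 1) + δ + (K₀ + K₁) * E n * (1 + (K₀ + K₁) * E n) * N n
      + (K₀ * E n * N (n + 1) + K₁ * E (n + 1) * N n)
  discrepancy_succ_le : ∀ n, G n → E n < ρ → E (n + 1) < ρ →
    r (n + 1) ≤ Q (n + 1) + (K₀ + K₁) * E (n + 1) * N (n + 1)
      + (K₀ + K₁) * E n * (1 + (K₀ + K₁) * E n) * N n
      + (K₀ * E n * N (n + 1) + K₁ * E (n + 1) * N n)

namespace IterationEstimates

variable {p ν γ b K₀ K₁ β ρ δ η : ℝ} {a E d N r Q R I : ℕ → ℝ} {G : ℕ → Prop}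

lemma solution_resid_le' (h : IterationEstimates p ν γ b K₀ K₁ β ρ δ a E d N r Q R I G)
    (hK₀ : 0 ≤ K₀) (hK₁ : 0 ≤ K₁) (hη : η ≤ 1) {n : ℕ} (hG : G n) (hE : E n < ρ)
    (hKE : (K₀ + K₁) * E n ≤ η) : R n ≤ δ + 2 * η * N n := by
  have h1 := h.solution_resid_le n hG hE
  have hN := h.N_nonneg n
  have h0 : 0 ≤ (K₀ + K₁) * E n := mul_nonneg (by linarith) (h.E_nonneg n)
  have h2 : (K₀ + K₁) * E n * (1 + (K₀ + K₁) * E n) ≤ η * 2 := by gcongr <;> linarith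
  nlinarith [mul_le_mul_of_nonneg_right h2 hN]

lemma discrepancy_le' (h : IterationEstimates p ν γ b K₀ K₁ β ρ δ a E d N r Q R I G)
    {n : ℕ} (hG : G n) (hE : E n < ρ)
    (hKE : (K₀ + K₁) * E n ≤ η) : r n ≤ δ + (1 + η) * N n := by
  have h1 := h.discrepancy_le n hG hE
  have hN := h.N_nonneg n
  nlinarith [mul_le_mul_of_nonneg_right hKE hN]

lemma image_le' (h : IterationEstimates p ν γ b K₀ K₁ β ρ δ a E d N r Q R I G)
    {n : ℕ} (hG : G n) (hE : E n < ρ)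
    (hKE : (K₀ + K₁) * E n ≤ η) : N n ≤ r n + δ + η * N n := by
  have h1 := h.image_le n hG hE
  have hN := h.N_nonneg n
  nlinarith [mul_le_mul_of_nonneg_right hKE hN]

/-- The two mixed terms pair distances and images of different iterates; each coefficient is at most
η because both iterates are close to x†. -/
lemma cross_le (h : IterationEstimates p ν γ b K₀ K₁ β ρ δ a E d N r Q R I G)
    (hK₀ : 0 ≤ K₀) (hK₁ : 0 ≤ K₁) (hη : η ≤ 1) {n : ℕ}
    (hKE : (K₀ + K₁) * E n ≤ η) (hKE' : (K₀ + K₁) * E (n + 1) ≤ η) :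
    (K₀ + K₁) * E n * (1 + (K₀ + K₁) * E n) * N n
      + (K₀ * E n * N (n + 1) + K₁ * E (n + 1) * N n) ≤ 3 * η * N n + η * N (n + 1) := by
  have hN := h.N_nonneg n
  have hN' := h.N_nonneg (n + 1)
  have hE := h.E_nonneg n
  have hE' := h.E_nonneg (n + 1)
  have h0 : 0 ≤ (K₀ + K₁) * E n := mul_nonneg (by linarith) (h.E_nonneg n)
  have h2 : (K₀ + K₁) * E n * (1 + (K₀ + K₁) * E n) ≤ η * 2 := by gcongr <;> linarith
  have h3 : K₀ * E n ≤ η := by nlinarith [mul_nonneg hK₁ hE]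
  have h4 : K₁ * E (n + 1) ≤ η := by nlinarith [mul_nonneg hK₀ hE']
  nlinarith [mul_le_mul_of_nonneg_right h2 hN, mul_le_mul_of_nonneg_right h3 hN',
    mul_le_mul_of_nonneg_right h4 hN]

lemma image_succ_le' (h : IterationEstimates p ν γ b K₀ K₁ β ρ δ a E d N r Q R I G)
    (hK₀ : 0 ≤ K₀) (hK₁ : 0 ≤ K₁) (hη : η ≤ 1) {n : ℕ} (hG : G n) (hE : E n < ρ)
    (hE' : E (n + 1) < ρ) (hKE : (K₀ + K₁) * E n ≤ η) (hKE' : (K₀ + K₁) * E (n + 1) ≤ η) :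
    N (n + 1) ≤ Q (n + 1) + δ + 3 * η * N n + η * N (n + 1) := by
  have h1 := h.image_succ_le n hG hE hE'
  have h2 := h.cross_le hK₀ hK₁ hη hKE hKE'
  linarith

lemma discrepancy_succ_le' (h : IterationEstimates p ν γ b K₀ K₁ β ρ δ a E d N r Q R I G)
    (hK₀ : 0 ≤ K₀) (hK₁ : 0 ≤ K₁) (hη : η ≤ 1) {n : ℕ} (hG : G n) (hE : E n < ρ)
    (hE' : E (n + 1) < ρ) (hKE : (K₀ + K₁) * E n ≤ η) (hKE' : (K₀ + K₁) * E (n + 1) ≤ η) :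
    r (n + 1) ≤ Q (n + 1) + 3 * η * N n + 2 * η * N (n + 1) := by
  have h1 := h.discrepancy_succ_le n hG hE hE'
  have h2 := h.cross_le hK₀ hK₁ hη hKE hKE'
  have h3 := mul_le_mul_of_nonneg_right hKE' (h.N_nonneg (n + 1))
  linarith

/-- All iterates up to the first index at which the noise dominates stay near the solution. -/
lemma apriori_bounds {g μ ϑ S M : ℝ} {k : ℕ}
    (h : IterationEstimates p ν γ (g * S) K₀ K₁ β ρ δ a E d N r Q R I G)
    (hp : 2 ≤ p) (hγ : 0 < γ) (hg : 0 < g) (hμ : 0 < μ) (hS : 0 ≤ S)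
    (hK₀ : 0 ≤ K₀) (hK₁ : 0 ≤ K₁) (hη₀ : 0 ≤ η) (hη : η ≤ 1 / 4) (hηM : 5 * η * M ≤ 1)
    (hM : M = 2 * ϑ * (2 * μ + g + 1)) (hϑ : 1 ≤ ϑ)
    (hημ : 2 * η * M ≤ (Real.sqrt (p / (p - 1)) - 1) * μ)
    (ha : ∀ n, 0 < a n) (haϑ : ∀ n, a n ≤ ϑ * a (n + 1))
    (hρ : (p / (p - 1) * γ * μ + 2 * (γ * g)) * S < ρ)
    (hKη : (K₀ + K₁) * ((p / (p - 1) * γ * μ + 2 * (γ * g)) * S) ≤ η)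
    (hk : ∀ n < k, δ ≤ μ * (a n * S)) :
    ∀ n ≤ k, G n ∧ E n < ρ ∧ (K₀ + K₁) * E n ≤ η ∧ N n ≤ M * (a n * S) := by
  have hp1 : 0 < p - 1 := by linarith
  have hp0 : 0 < p := by linarith
  have hgS : 0 ≤ g * S := by positivity
  have hM0 : 0 ≤ M := by rw [hM]; positivity
  have hK : 0 ≤ K₀ + K₁ := by linarith
  have hdE : ∀ n, G n → d n ≤ p / (p - 1) * (μ * S) + 2 * (g * S) →
      E n < ρ ∧ (K₀ + K₁) * E n ≤ η := by
    intro n hG hd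
    have h1 : E n ≤ (p / (p - 1) * γ * μ + 2 * (γ * g)) * S := by
      have := mul_le_mul_of_nonneg_left hd hγ.le
      linarith [h.dist_le n hG]
    exact ⟨h1.trans_lt hρ, (mul_le_mul_of_nonneg_left h1 hK).trans hKη⟩
  have hc : 0 ≤ p / (p - 1) * (μ * S) := by positivity
  intro n
  induction n with
  | zero =>
    intro _
    have hd : d 0 ≤ g * S := by
      refine le_of_rpow_le_mul_rpow (e := 1) (p := p) (by linarith) hgS ?_
      simpa using h.init_le.trans (h.pairing_le 0 h.init_mem)
    have hE := hdE 0 h.init_mem (by linarith)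
    refine ⟨h.init_mem, hE.1, hE.2, ?_⟩
    have ha0 := ha 0
    calc N 0 ≤ a 0 / γ * E 0 := h.init_image_le
      _ ≤ a 0 / γ * (γ * (g * S)) := by
          have := h.dist_le 0 h.init_mem
          have : E 0 ≤ γ * (g * S) := this.trans (by gcongr)
          gcongr
      _ = g * (a 0 * S) := by field_simp
      _ ≤ M * (a 0 * S) := by
          have : g ≤ M := by rw [hM]; nlinarith
          gcongr
  | succ n ih =>
    intro hn
    obtain ⟨hG, hE, hKE, hN⟩ := ih (by omega)
    have hδ := hk n (by omega)
    have han := ha n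
    have hN0 := h.N_nonneg n
    have haS : 0 ≤ a n * S := by positivity
    have hG' := h.step_mem n hG hE
    have hR := h.solution_resid_le' hK₀ hK₁ (by linarith) hG hE hKE
    have hηN : η * N n ≤ η * (M * (a n * S)) := by gcongr
    have hstep : Q (n + 1) ^ p + a n ^ p * d (n + 1) ^ p
        ≤ R n ^ p + a n ^ p * ((g * S) ^ (p - 1) * d (n + 1)) := by
      have := h.pairing_le (n + 1) hG'
      have h1 := h.step_le n hG hE
      have h2 := mul_le_mul_of_nonneg_left this (Real.rpow_nonneg han.le p)
      linarith
    -- R_n ≤ δ + 2ηN_n ≤ (μ + 2ηM) a_n S, and `hημ` fits this below √(p/(p−1)) μ a_n S.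
    have hd : d (n + 1) ≤ p / (p - 1) * (μ * S) + 2 * (g * S) := by
      refine le_of_step_linear hp han hgS (h.Q_nonneg _) (h.R_nonneg _) ?_ (by positivity) hstep
      have h1 := mul_le_mul_of_nonneg_right hημ haS
      nlinarith
    obtain ⟨hE', hKE'⟩ := hdE (n + 1) hG' hd
    refine ⟨hG', hE', hKE', ?_⟩
    have hQ : Q (n + 1) ≤ R n + a n * (g * S) :=
      resid_le_of_step (p := p) (e := 1) (by linarith) (by norm_num) (by linarith) han hgS
        (h.d_nonneg _) (h.R_nonneg _) (by simpa using hstep)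
    have hN' := h.image_succ_le' hK₀ hK₁ (by linarith) hG hE hE' hKE hKE'
    have hN0' := h.N_nonneg (n + 1)
    have h3 : η * N (n + 1) ≤ 1 / 4 * N (n + 1) := by gcongr
    have h4 : η * (M * (a n * S)) * 5 ≤ 1 * (a n * S) := by
      have := mul_le_mul_of_nonneg_right hηM haS
      linarith
    -- Two noise terms give 2μ, the residual bound gives g, and 5ηN_n gives 1. Passing from a_n to
    -- a_{n+1} costs ϑ, whence the form of M.
    have h5 : 3 / 4 * N (n + 1) ≤ (2 * μ + g + 1) * (a n * S) := by nlinarith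
    have h6 : a n * S ≤ ϑ * a (n + 1) * S := mul_le_mul_of_nonneg_right (haϑ n) hS
    have h7 := mul_le_mul_of_nonneg_left h6 (show 0 ≤ 2 * μ + g + 1 by positivity)
    have ha' := ha (n + 1)
    have h8 : 0 ≤ (2 * μ + g + 1) * (ϑ * a (n + 1) * S) := by positivity
    rw [hM]
    linarith

/-- An index up to which all iterates stay near the solution and at which both discrepancy rules
stop. -/
lemma exists_index_discrepancy_le {p γ g μ ϑ τ η₀ : ℝ} (hp : 2 ≤ p) (hγ : 0 < γ) (hg : 0 < g)
    (hμ : 0 < μ) (hϑ : 1 ≤ ϑ) (hμτ : g * ϑ ^ 2 * μ⁻¹ < (τ - 1) / 2) (hη₀ : 0 < η₀) :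
    ∃ ε : ℝ, 0 < ε ∧ ∀ (ν S K₀ K₁ β ρ δ : ℝ) (a E d N r Q R I : ℕ → ℝ) (G : ℕ → Prop),
      IterationEstimates p ν γ (g * S) K₀ K₁ β ρ δ a E d N r Q R I G →
      0 ≤ S → 0 ≤ K₀ → 0 ≤ K₁ → 0 < δ → (∀ n, 0 < a n) → (∀ n, a (n + 1) ≤ a n) →
      (∀ n, a n ≤ ϑ * a (n + 1)) → Tendsto a atTop (𝓝 0) →
      (p / (p - 1) * γ * μ + 2 * (γ * g)) * S < ρ → (K₀ + K₁) * S ≤ ε →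
      ∃ k, (∀ n ≤ k, G n ∧ E n < ρ ∧ (K₀ + K₁) * E n ≤ η₀) ∧
        (r 0 ≤ τ * δ ∨ (2 ≤ k ∧ r k ≤ τ * δ ∧ r (k - 1) ≤ τ * δ)) := by
  have hp1 : 0 < p - 1 := by linarith
  have hp0 : 0 < p := by linarith
  have hτ : 0 < τ - 1 := by
    have : 0 < g * ϑ ^ 2 * μ⁻¹ := by positivity
    linarith
  obtain ⟨M, hM⟩ : ∃ M, M = 2 * ϑ * (2 * μ + g + 1) := ⟨_, rfl⟩
  have hM0 : 0 < M := by rw [hM]; positivity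
  have hsq : 0 < Real.sqrt (p / (p - 1)) - 1 := by
    rw [sub_pos]
    apply Real.lt_sqrt_of_sq_lt
    rw [one_pow, one_lt_div hp1]
    linarith
  -- The bounds involving M respectively close the induction for N, keep d within the radius, and
  -- limit the nonlinear part of the final discrepancy to half of τ − 1; the condition on μ supplies
  -- the other half.
  obtain ⟨η, hη, hη1, hη2, hη3, hη4, hη5⟩ : ∃ η : ℝ, 0 < η ∧ η ≤ η₀ ∧ η ≤ 1 / 4 ∧
      5 * η * M ≤ 1 ∧ 2 * η * M ≤ (Real.sqrt (p / (p - 1)) - 1) * μ ∧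
      7 * η * M * (ϑ ^ 2 * μ⁻¹) ≤ (τ - 1) / 2 := by
    have ht : ∀ c : ℝ, Tendsto (fun η : ℝ => c * η) (𝓝[>] 0) (𝓝 0) := fun c => by
      have : Tendsto (fun η : ℝ => c * η) (𝓝 0) (𝓝 (c * 0)) := by
        exact (continuous_const.mul continuous_id).tendsto 0
      rw [mul_zero] at this
      exact this.mono_left nhdsWithin_le_nhds
    have hev : ∀ c t : ℝ, 0 < t → ∀ᶠ η in 𝓝[>] (0 : ℝ), c * η ≤ t := fun c t h0 =>
      ((ht c).eventually (gt_mem_nhds h0)).mono fun _ h => le_of_lt h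
    obtain ⟨η, h1, h2, h3, h4, h5, h6⟩ := ((eventually_mem_nhdsWithin (s := Set.Ioi (0 : ℝ))).and
      ((hev 1 η₀ hη₀).and ((hev 1 (1 / 4) (by norm_num)).and ((hev (5 * M) 1 one_pos).and
      ((hev (2 * M) _ (mul_pos hsq hμ)).and
        (hev (7 * M * (ϑ ^ 2 * μ⁻¹)) ((τ - 1) / 2) (by linarith))))))).exists
    exact ⟨η, h1, by linarith, by linarith, by linarith, by linarith, by linarith⟩
  set c := p / (p - 1) * γ * μ + 2 * (γ * g) with hc
  have hc0 : 0 < c := by positivity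
  -- The a priori distance bound is cS, so this choice makes (K₀ + K₁)E at most η.
  refine ⟨η / c, by positivity, ?_⟩
  intro ν S K₀ K₁ β ρ δ a E d N r Q R I G h hS hK₀ hK₁ hδ ha hanti haϑ hlim hρ hKS
  have hKη : (K₀ + K₁) * (c * S) ≤ η := by
    rw [le_div_iff₀ hc0] at hKS
    linarith
  have hex : ∃ k, μ * (a k * S) ≤ δ := by
    have : Tendsto (fun n => μ * (a n * S)) atTop (𝓝 (μ * (0 * S))) :=
      (hlim.mul_const S).const_mul μ
    rw [zero_mul, mul_zero] at this
    obtain ⟨k, hk⟩ := (this.eventually (gt_mem_nhds hδ)).exists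
    exact ⟨k, hk.le⟩
  classical
  obtain ⟨k, hk, hkmin⟩ : ∃ k, μ * (a k * S) ≤ δ ∧ ∀ n < k, δ ≤ μ * (a n * S) :=
    ⟨Nat.find hex, Nat.find_spec hex, fun n hn => (not_le.1 (Nat.find_min hex hn)).le⟩
  have hb := h.apriori_bounds hp hγ hg hμ hS hK₀ hK₁ hη.le hη2 hη3 hM hϑ hη4 ha haϑ hρ hKη hkmin
  refine ⟨k, fun n hn => ⟨(hb n hn).1, (hb n hn).2.1, (hb n hn).2.2.1.trans hη1⟩, ?_⟩
  have hgS : 0 ≤ g * S := by positivity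
  have hϑ2 : ϑ ≤ ϑ ^ 2 := by nlinarith
  -- near the last index the regularization parameter is comparable to the noise level
  have hlast : ∀ n, k ≤ n + 2 → a n * S ≤ ϑ ^ 2 * μ⁻¹ * δ := by
    intro n hn
    have h1 : a n ≤ ϑ ^ 2 * a (n + 2) := by
      have h1 := haϑ n
      have h2 := mul_le_mul_of_nonneg_left (haϑ (n + 1)) (show 0 ≤ ϑ by linarith)
      linarith
    have h2 : a (n + 2) ≤ a k := antitone_nat_of_succ_le hanti hn
    have h3 : a k * S ≤ μ⁻¹ * δ := by
      rw [inv_mul_eq_div, le_div_iff₀ hμ]; linarith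
    calc a n * S ≤ ϑ ^ 2 * a k * S := by
          apply mul_le_mul_of_nonneg_right _ hS
          exact h1.trans (by gcongr)
      _ = ϑ ^ 2 * (a k * S) := by ring
      _ ≤ ϑ ^ 2 * (μ⁻¹ * δ) := by gcongr
      _ = _ := by ring
  -- The step producing x_{k−1} uses a_{k−2} ≤ ϑ² a_k; this is why two powers of ϑ appear in the
  -- condition on μ.
  have hsmall : ∀ n, n + 1 ≤ k → k ≤ n + 2 → r (n + 1) ≤ τ * δ := by
    intro n hn1 hn2
    obtain ⟨hG, hE, hKE, hN⟩ := hb n (by omega)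
    obtain ⟨hG', hE', hKE', hN'⟩ := hb (n + 1) hn1
    have han := ha n
    have hstep : Q (n + 1) ^ p + a n ^ p * d (n + 1) ^ p
        ≤ R n ^ p + a n ^ p * ((g * S) ^ (p - 1) * d (n + 1) ^ (1 : ℝ)) := by
      have := h.pairing_le (n + 1) hG'
      have h1 := h.step_le n hG hE
      have h2 := mul_le_mul_of_nonneg_left this (Real.rpow_nonneg han.le p)
      rw [Real.rpow_one]
      linarith
    have hQ : Q (n + 1) ≤ R n + a n * (g * S) :=
      resid_le_of_step (by linarith) (by norm_num) (by linarith) han hgS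
        (h.d_nonneg _) (h.R_nonneg _) hstep
    have hR := h.solution_resid_le' hK₀ hK₁ (by linarith) hG hE hKE
    have hr := h.discrepancy_succ_le' hK₀ hK₁ (by linarith) hG hE hE' hKE hKE'
    have h1 : M * (a (n + 1) * S) ≤ M * (a n * S) := by
      have := hanti n
      gcongr
    have h2 := mul_le_mul_of_nonneg_left hN hη.le
    have h3 := mul_le_mul_of_nonneg_left (hN'.trans h1) hη.le
    have h4 : r (n + 1) ≤ δ + (7 * η * M + g) * (a n * S) := by linarith
    have h5 := mul_le_mul_of_nonneg_left (hlast n hn2) (show 0 ≤ 7 * η * M + g by positivity)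
    have h6 : (7 * η * M + g) * (ϑ ^ 2 * μ⁻¹) ≤ τ - 1 := by linarith
    have h7 := mul_le_mul_of_nonneg_right h6 hδ.le
    linarith
  rcases le_or_gt 2 k with h2k | hk2
  · obtain ⟨j, rfl⟩ : ∃ j, k = j + 2 := ⟨k - 2, by omega⟩
    exact Or.inr ⟨h2k, hsmall (j + 1) (by omega) (by omega), hsmall j (by omega) (by omega)⟩
  -- For k < 2 no two iterates after the start are available, but a_0 S is already of order δ, and
  -- r_0 ≤ δ + 2g a_0 S suffices.
  · left
    obtain ⟨hG, hE, hKE, -⟩ := hb 0 (by omega)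
    have hd : d 0 ≤ g * S := by
      refine le_of_rpow_le_mul_rpow (e := 1) (p := p) (by linarith) hgS ?_
      simpa using h.init_le.trans (h.pairing_le 0 h.init_mem)
    have hN : N 0 ≤ g * (a 0 * S) := by
      have ha0 := ha 0
      calc N 0 ≤ a 0 / γ * E 0 := h.init_image_le
        _ ≤ a 0 / γ * (γ * (g * S)) := by
            have : E 0 ≤ γ * (g * S) := (h.dist_le 0 h.init_mem).trans (by gcongr)
            gcongr
        _ = g * (a 0 * S) := by field_simp
    have hr := h.discrepancy_le' hG hE hKE
    have hN0 := h.N_nonneg 0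
    have h1 : (1 + η) * N 0 ≤ 2 * (g * (ϑ ^ 2 * μ⁻¹ * δ)) := by
      have := mul_le_mul_of_nonneg_left (hlast 0 (by omega)) hg.le
      nlinarith
    have h2 := mul_le_mul_of_nonneg_right hμτ.le hδ.le
    linarith

end IterationEstimates

end Recursion

/-! ### The convergence rate from the source condition. -/

section Recursion

namespace IterationEstimates

variable {p ν γ b K₀ K₁ β ρ δ η : ℝ} {a E d N r Q R I : ℕ → ℝ} {G : ℕ → Prop}

lemma source_rpow (hν : 0 < ν) (hp : 2 ≤ p) (hβ : 0 ≤ β) {N : ℝ} (hN : 0 ≤ N) :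
    (β ^ (1 / (p - 1 + ν)) * N ^ (ν / (p - 1 + ν))) ^ (p - (1 - ν)) = β * N ^ ν := by
  have hq : 0 < p - 1 + ν := by linarith
  rw [Real.mul_rpow (by positivity) (by positivity), ← Real.rpow_mul hβ, ← Real.rpow_mul hN]
  have h1 : 1 / (p - 1 + ν) * (p - (1 - ν)) = 1 := by field_simp; ring
  have h2 : ν / (p - 1 + ν) * (p - (1 - ν)) = ν := by field_simp; ring
  rw [h1, h2, Real.rpow_one]

/-- With q = p − 1 + ν and κ = ν/q, the scale ω = a^(q/(p−1)) β^(1/(p−1)) is the one at which N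
balances a β^(1/q) N^κ, so that the latter is ω^(1−κ) N^κ. -/
lemma mul_source_rpow (hν : 0 < ν) (hp : 2 ≤ p) (hβ : 0 ≤ β) {a : ℝ} (ha : 0 < a) :
    (a ^ ((p - 1 + ν) / (p - 1)) * β ^ (1 / (p - 1))) ^ (1 - ν / (p - 1 + ν))
      = a * β ^ (1 / (p - 1 + ν)) := by
  have hq : 0 < p - 1 + ν := by linarith
  have hp1 : 0 < p - 1 := by linarith
  rw [Real.mul_rpow (by positivity) (by positivity), ← Real.rpow_mul hβ, ← Real.rpow_mul ha.le]
  have h1 : (p - 1 + ν) / (p - 1) * (1 - ν / (p - 1 + ν)) = 1 := by field_simp; ring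
  have h2 : 1 / (p - 1) * (1 - ν / (p - 1 + ν)) = 1 / (p - 1 + ν) := by field_simp; ring
  rw [h1, h2, Real.rpow_one]

lemma init_dist_le (h : IterationEstimates p ν γ b K₀ K₁ β ρ δ a E d N r Q R I G)
    (hν : 0 < ν) (hp : 2 ≤ p) (hβ : 0 ≤ β) :
    d 0 ≤ β ^ (1 / (p - 1 + ν)) * N 0 ^ (ν / (p - 1 + ν)) := by
  have hN := h.N_nonneg 0
  refine le_of_rpow_le_mul_rpow (e := 1 - ν) (p := p) (by linarith) (by positivity) ?_
  rw [source_rpow hν hp hβ hN]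
  linarith [h.init_le, h.source_le 0 h.init_mem]

lemma step_le_source (h : IterationEstimates p ν γ b K₀ K₁ β ρ δ a E d N r Q R I G)
    (hν : 0 < ν) (hp : 2 ≤ p) (hβ : 0 ≤ β) (ha : ∀ n, 0 < a n) {n : ℕ} (hG : G n)
    (hE : E n < ρ) :
    Q (n + 1) ^ p + a n ^ p * d (n + 1) ^ p ≤ R n ^ p + a n ^ p *
      ((β ^ (1 / (p - 1 + ν)) * N (n + 1) ^ (ν / (p - 1 + ν))) ^ (p - (1 - ν))
        * d (n + 1) ^ (1 - ν)) := by
  rw [source_rpow hν hp hβ (h.N_nonneg _)]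
  have h1 := h.step_le n hG hE
  have h2 := mul_le_mul_of_nonneg_left (h.source_le (n + 1) (h.step_mem n hG hE))
    (Real.rpow_nonneg (ha n).le p)
  linarith

lemma resid_le_source (h : IterationEstimates p ν γ b K₀ K₁ β ρ δ a E d N r Q R I G)
    (hν : 0 < ν) (hν₁ : ν ≤ 1) (hp : 2 ≤ p) (hβ : 0 ≤ β) (ha : ∀ n, 0 < a n) {n : ℕ} (hG : G n)
    (hE : E n < ρ) :
    Q (n + 1) ≤ R n + (a n ^ ((p - 1 + ν) / (p - 1)) * β ^ (1 / (p - 1)))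
        ^ (1 - ν / (p - 1 + ν)) * N (n + 1) ^ (ν / (p - 1 + ν)) := by
  have hN := h.N_nonneg (n + 1)
  rw [mul_source_rpow hν hp hβ (ha n), mul_assoc]
  exact resid_le_of_step (e := 1 - ν) (by linarith) (by linarith) (by linarith) (ha n)
    (by positivity) (h.d_nonneg _) (h.R_nonneg _) (h.step_le_source hν hp hβ ha hG hE)

lemma dist_le_source (h : IterationEstimates p ν γ b K₀ K₁ β ρ δ a E d N r Q R I G)
    (hν : 0 < ν) (hp : 2 ≤ p) (hβ : 0 ≤ β) (ha : ∀ n, 0 < a n) {n : ℕ} (hG : G n)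
    (hE : E n < ρ) :
    d (n + 1) ≤ 2 * (R n / a n) + 2 * (β ^ (1 / (p - 1 + ν)) * N (n + 1) ^ (ν / (p - 1 + ν))) := by
  have hN := h.N_nonneg (n + 1)
  exact dist_le_of_step (e := 1 - ν) (by linarith) (by linarith) (ha n)
    (by positivity) (h.d_nonneg _) (h.Q_nonneg _) (h.R_nonneg _)
    (h.step_le_source hν hp hβ ha hG hE)

/-- Under the source condition the linearized errors are of the order of the noise level plus the
power `a ^ (q / (p - 1)) * β ^ (1 / (p - 1))` of the regularization parameter,
`q = p - 1 + ν`. -/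
lemma image_le_source {L H P : ℝ} {ω : ℕ → ℝ} {k : ℕ}
    (h : IterationEstimates p ν γ b K₀ K₁ β ρ δ a E d N r Q R I G)
    (hν : 0 < ν) (hν₁ : ν ≤ 1) (hp : 2 ≤ p) (hγ : 0 < γ) (hβ : 0 ≤ β) (hδ : 0 < δ)
    (hK₀ : 0 ≤ K₀) (hK₁ : 0 ≤ K₁) (ha : ∀ n, 0 < a n)
    (hω : ∀ n, ω n = a n ^ ((p - 1 + ν) / (p - 1)) * β ^ (1 / (p - 1)))
    (hL : 1 ≤ L) (hωL : ∀ n, ω n ≤ L * ω (n + 1)) (hH : 0 ≤ H)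
    (hY : ∀ ω N : ℝ, 0 ≤ ω → 0 ≤ N →
      ω ^ (1 - ν / (p - 1 + ν)) * N ^ (ν / (p - 1 + ν)) ≤ 1 / 2 * N + H * ω)
    (hP : P = 16 + 4 * H * L) (hη₀ : 0 ≤ η) (hη : η ≤ 1 / 4) (hηP : 20 * η * P * L ≤ 8)
    (hk : ∀ n ≤ k, G n ∧ E n < ρ ∧ (K₀ + K₁) * E n ≤ η) :
    N 0 ≤ ω 0 ∧ ∀ n ≤ k, N n ≤ P * (ω n + δ) := by
  have hP0 : 0 < P := by rw [hP]; positivity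
  have hω0 : ∀ n, 0 ≤ ω n := fun n => by rw [hω]; have := ha n; positivity
  have hq : 0 < p - 1 + ν := by linarith
  have hN0 : N 0 ≤ ω 0 := by
    have h1 := h.init_dist_le hν hp hβ
    have ha0 := ha 0
    refine le_of_rpow_le_mul_rpow (e := ν / (p - 1 + ν)) (p := 1)
      (by rw [div_lt_one hq]; linarith) (hω0 0) ?_
    rw [hω, mul_source_rpow hν hp hβ ha0, Real.rpow_one]
    calc N 0 ≤ a 0 / γ * E 0 := h.init_image_le
      _ ≤ a 0 / γ * (γ * d 0) := by
          have := h.dist_le 0 h.init_mem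
          gcongr
      _ = a 0 * d 0 := by field_simp
      _ ≤ a 0 * (β ^ (1 / (p - 1 + ν)) * N 0 ^ (ν / (p - 1 + ν))) := by gcongr
      _ = _ := by ring
  refine ⟨hN0, ?_⟩
  intro n
  induction n with
  | zero =>
    intro _
    have h1 : 1 ≤ P := by rw [hP]; nlinarith [mul_nonneg hH (zero_le_one.trans hL)]
    have := hω0 0
    nlinarith
  | succ n ih =>
    intro hn
    have hN := ih (by omega)
    obtain ⟨hG, hE, hKE⟩ := hk n (by omega)
    obtain ⟨hG', hE', hKE'⟩ := hk (n + 1) hn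
    have hQ := h.resid_le_source hν hν₁ hp hβ ha hG hE
    rw [← hω] at hQ
    have hy := hY (ω n) (N (n + 1)) (hω0 n) (h.N_nonneg _)
    have hR := h.solution_resid_le' hK₀ hK₁ (by linarith) hG hE hKE
    have hS := h.image_succ_le' hK₀ hK₁ (by linarith) hG hE hE' hKE hKE'
    have h1 : η * N (n + 1) ≤ 1 / 4 * N (n + 1) :=
      mul_le_mul_of_nonneg_right hη (h.N_nonneg _)
    -- Young absorbs half of N_{n+1} and the nonlinearity a quarter; the remaining quarter explains
    -- the factor 4.
    have h2 : N (n + 1) ≤ 8 * δ + 20 * (η * N n) + 4 * (H * ω n) := by linarith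
    have h3 := mul_le_mul_of_nonneg_left hN hη₀
    have h4 := mul_le_mul_of_nonneg_left (hωL n) hH
    have h5 : ω n + δ ≤ L * (ω (n + 1) + δ) := by nlinarith [hωL n]
    have h6 := mul_le_mul_of_nonneg_left h5 (mul_nonneg hη₀ hP0.le)
    have h7 := mul_le_mul_of_nonneg_right hηP (add_nonneg (hω0 (n + 1)) hδ.le)
    have h8 : N (n + 1) ≤ 16 * δ + 8 * ω (n + 1) + 4 * (H * (L * ω (n + 1))) := by linarith
    have h9 : 0 ≤ H * L * δ := by positivity
    have h10 := hω0 (n + 1)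
    rw [hP]
    linarith

/-- The convergence rate at an index at which a discrepancy rule stops. -/
lemma exists_rate {p ν γ ϑ τ : ℝ} (hp : 2 ≤ p) (hγ : 0 < γ) (hϑ : 1 ≤ ϑ) (hτ : 1 < τ)
    (hν : 0 < ν) (hν₁ : ν ≤ 1) :
    ∃ η C : ℝ, 0 < η ∧ 0 < C ∧
    ∀ (b K₀ K₁ β ρ δ : ℝ) (a E d N r Q R I : ℕ → ℝ) (G : ℕ → Prop) (k : ℕ),
      IterationEstimates p ν γ b K₀ K₁ β ρ δ a E d N r Q R I G →
      0 ≤ K₀ → 0 ≤ K₁ → 0 ≤ β → 0 < δ → (∀ n, 0 < a n) → (∀ n, a n ≤ ϑ * a (n + 1)) →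
      (∀ n ≤ k, G n ∧ E n < ρ ∧ (K₀ + K₁) * E n ≤ η) →
      (r 0 ≤ τ * δ → d 0 ≤ C * (β ^ (1 / (p - 1 + ν)) * δ ^ (ν / (p - 1 + ν)))) ∧
      ∀ n, n + 1 ≤ k → (∃ j ≤ n, n ≤ j + 1 ∧ τ * δ < r j) → r n ≤ 2 * τ * δ →
        r (n + 1) ≤ 2 * τ * δ →
        d (n + 1) ≤ C * (β ^ (1 / (p - 1 + ν)) * δ ^ (ν / (p - 1 + ν))) := by
  have hp1 : 0 < p - 1 := by linarith
  have hq : 0 < p - 1 + ν := by linarith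
  set κ := ν / (p - 1 + ν) with hκ
  have hκ₀ : 0 < κ := by positivity
  have hκ₁ : κ < 1 := by rw [hκ, div_lt_one hq]; linarith
  obtain ⟨L, hLdef⟩ : ∃ L, L = ϑ ^ ((p - 1 + ν) / (p - 1)) := ⟨_, rfl⟩
  have hL : 1 ≤ L := by rw [hLdef]; exact Real.one_le_rpow hϑ (by positivity)
  obtain ⟨H, hH, hY⟩ := exists_rpow_mul_rpow_le hκ₀.le hκ₁ (σ := 1 / 2) (by norm_num)
  obtain ⟨P, hP⟩ : ∃ P, P = 16 + 4 * H * L := ⟨_, rfl⟩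
  have hP0 : 0 < P := by rw [hP]; positivity
  have hτ1 : 0 < τ - 1 := by linarith
  -- A second Young constant: σP and 7ηP each take a quarter of τ − 1, so the coefficient of δ in
  -- the discrepancy stays strictly below τ.
  obtain ⟨σ, hσdef⟩ : ∃ σ, σ = (τ - 1) / (4 * P) := ⟨_, rfl⟩
  have hσ0 : 0 < σ := by rw [hσdef]; positivity
  have hσP : σ * P = (τ - 1) / 4 := by rw [hσdef]; field_simp
  obtain ⟨H', hH', hY'⟩ := exists_rpow_mul_rpow_le hκ₀.le hκ₁ hσ0
  obtain ⟨η, hη0, hη1, hη2, hη3⟩ : ∃ η : ℝ, 0 < η ∧ η ≤ 1 / 4 ∧ 20 * η * P * L ≤ 8 ∧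
      7 * η * P ≤ (τ - 1) / 4 := by
    refine ⟨min (1 / 4) (min (8 / (20 * P * L)) ((τ - 1) / (28 * P))), by positivity,
      min_le_left _ _, ?_, ?_⟩
    · have h1 := (min_le_right (1 / 4 : ℝ) (min (8 / (20 * P * L)) ((τ - 1) / (28 * P)))).trans
        (min_le_left _ _)
      rw [le_div_iff₀ (by positivity)] at h1
      linarith
    · have h1 := (min_le_right (1 / 4 : ℝ) (min (8 / (20 * P * L)) ((τ - 1) / (28 * P)))).trans
        (min_le_right _ _)
      rw [le_div_iff₀ (by positivity)] at h1
      linarith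
  obtain ⟨J, hJ⟩ : ∃ J, J = 2 + L * ((τ - 1) / 2 + H') := ⟨_, rfl⟩
  have hJ0 : 0 < J := by rw [hJ]; positivity
  -- From τδ < r_j ≤ (1 + (τ − 1)/2)δ + Jω_j and ω_j ≤ Lω_n one gets δ ≤ J'ω_n.
  obtain ⟨J', hJ'⟩ : ∃ J', J' = 2 * J * L / (τ - 1) := ⟨_, rfl⟩
  have hJ'0 : 0 < J' := by rw [hJ']; positivity
  obtain ⟨B, hB⟩ : ∃ B, B = 2 * (2 * τ + 1) := ⟨_, rfl⟩
  have hB0 : 0 < B := by rw [hB]; positivity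
  refine ⟨η, 2 * ((1 + B) * J' ^ (1 - κ)) + 2 * B ^ κ, hη0, by positivity, ?_⟩
  intro b K₀ K₁ β ρ δ a E d N r Q R I G k h hK₀ hK₁ hβ hδ ha haϑ hk
  set Z := β ^ (1 / (p - 1 + ν)) * δ ^ κ with hZ
  have hZ0 : 0 ≤ Z := by positivity
  obtain ⟨ω, hω⟩ : ∃ ω : ℕ → ℝ, ∀ n, ω n = a n ^ ((p - 1 + ν) / (p - 1)) * β ^ (1 / (p - 1)) :=
    ⟨_, fun _ => rfl⟩
  have hω0 : ∀ n, 0 ≤ ω n := fun n => by rw [hω]; have := ha n; positivity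
  have hωL : ∀ n, ω n ≤ L * ω (n + 1) := fun n => by
    have h1 := ha n
    have h2 := ha (n + 1)
    rw [hω, hω, hLdef, ← mul_assoc, ← Real.mul_rpow (by linarith) h2.le]
    have := haϑ n
    gcongr
  obtain ⟨hN0, hN⟩ := h.image_le_source hν hν₁ hp hγ hβ hδ hK₀ hK₁ ha hω hL hωL hH.le hY hP
    hη0.le hη1 hη2 hk
  -- a small discrepancy bounds the linearized error by the noise level
  have hNB : ∀ n ≤ k, r n ≤ 2 * τ * δ → N n ≤ B * δ := by
    intro n hn hr
    obtain ⟨hG, hE, hKE⟩ := hk n hn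
    have h1 := h.image_le' hG hE hKE
    have h2 := mul_le_mul_of_nonneg_right hη1 (h.N_nonneg n)
    have h3 : 0 ≤ (2 * τ + 1) * δ := by positivity
    rw [hB]
    linarith
  have hwB : ∀ n ≤ k, r n ≤ 2 * τ * δ → β ^ (1 / (p - 1 + ν)) * N n ^ κ ≤ B ^ κ * Z := by
    intro n hn hr
    have h1 := h.N_nonneg n
    calc β ^ (1 / (p - 1 + ν)) * N n ^ κ ≤ β ^ (1 / (p - 1 + ν)) * (B * δ) ^ κ := by
          have := hNB n hn hr
          gcongr
      _ = B ^ κ * Z := by rw [Real.mul_rpow hB0.le hδ.le, hZ]; ring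
  -- large discrepancies occur only when the noise level is dominated
  have hr : ∀ n ≤ k, r n ≤ (1 + (τ - 1) / 2) * δ + J * ω n := by
    intro n hn
    obtain ⟨hG', hE', hKE'⟩ := hk n hn
    have hω' := hω0 n
    rcases n with _ | n
    · have h1 := h.discrepancy_le' hG' hE' hKE'
      have h2 : 2 ≤ J := by rw [hJ]; have : 0 ≤ L * ((τ - 1) / 2 + H') := by positivity
                            linarith
      have h3 := mul_le_mul_of_nonneg_right h2 hω'
      have h4 := mul_le_mul_of_nonneg_right hη1 (h.N_nonneg 0)
      have h5 := h.N_nonneg 0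
      have h6 : 0 ≤ (τ - 1) / 2 * δ := by positivity
      linarith
    · obtain ⟨hG, hE, hKE⟩ := hk n (by omega)
      have hQ := h.resid_le_source hν hν₁ hp hβ ha hG hE
      rw [← hω, ← hκ] at hQ
      have hy := hY' (ω n) (N (n + 1)) (hω0 n) (h.N_nonneg _)
      have hR := h.solution_resid_le' hK₀ hK₁ (by linarith) hG hE hKE
      have hD := h.discrepancy_succ_le' hK₀ hK₁ (by linarith) hG hE hE' hKE hKE'
      have h1 := mul_le_mul_of_nonneg_left (hN n (by omega)) hη0.le
      have h2 := mul_le_mul_of_nonneg_left (hN (n + 1) hn) (show 0 ≤ 2 * η + σ by positivity)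
      have h3 := hωL n
      have h4 := mul_le_mul_of_nonneg_left h3 hH'.le
      have h5 := mul_le_mul_of_nonneg_left h3 (show 0 ≤ 5 * η * P by positivity)
      have h6 := mul_le_mul_of_nonneg_right hL hω'
      have h7 := mul_le_mul_of_nonneg_left h6 (show 0 ≤ 2 * η * P + σ * P by positivity)
      have h8 : r (n + 1) ≤ δ + (7 * η * P + σ * P) * δ
          + L * (7 * η * P + σ * P + H') * ω (n + 1) := by linarith
      have h9 : 7 * η * P + σ * P ≤ (τ - 1) / 2 := by linarith
      have h10 := mul_le_mul_of_nonneg_right h9 hδ.le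
      have h11 := mul_le_mul_of_nonneg_right h9 (show 0 ≤ L * ω (n + 1) by positivity)
      rw [hJ]
      linarith
  refine ⟨fun hr0 => ?_, ?_⟩
  · have h1 := h.init_dist_le hν hp hβ
    have h2 := hwB 0 (Nat.zero_le _) (by nlinarith)
    have h3 : 0 ≤ (2 * ((1 + B) * J' ^ (1 - κ)) + B ^ κ) * Z := by positivity
    linarith
  · rintro n hnk ⟨j, hjn, hnj, hj⟩ hrn hrn'
    obtain ⟨hG, hE, hKE⟩ := hk n (by omega)
    have han := ha n
    have hωj : ω j ≤ L * ω n := by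
      rcases hjn.eq_or_lt with rfl | hlt
      · exact le_mul_of_one_le_left (hω0 _) hL
      · obtain rfl : n = j + 1 := by omega
        exact hωL j
    have hδω : δ ≤ J' * ω n := by
      have h1 := hr j (by omega)
      have h2 : (τ - 1) * δ ≤ 2 * J * L * ω n := by
        have := mul_le_mul_of_nonneg_left hωj hJ0.le
        linarith
      rw [hJ', div_mul_eq_mul_div, le_div_iff₀ hτ1]
      linarith
    -- Only the factor δ^(1−κ) is traded for ω_n^(1−κ) = a_n β^(1/q); the kept δ^κ produces the
    -- rate.
    have hδZ : δ ≤ J' ^ (1 - κ) * Z * a n := by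
      have h1 : δ ^ (1 - κ) ≤ (J' * ω n) ^ (1 - κ) :=
        Real.rpow_le_rpow hδ.le hδω (by linarith)
      rw [Real.mul_rpow hJ'0.le (hω0 n), hω, mul_source_rpow hν hp hβ han] at h1
      calc δ = δ ^ (1 - κ) * δ ^ κ := by
            rw [← Real.rpow_add hδ, sub_add_cancel, Real.rpow_one]
        _ ≤ J' ^ (1 - κ) * (a n * β ^ (1 / (p - 1 + ν))) * δ ^ κ := by gcongr
        _ = _ := by rw [hZ]; ring
    have hR := h.solution_resid_le' hK₀ hK₁ (by linarith) hG hE hKE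
    have hRa : R n / a n ≤ (1 + B) * J' ^ (1 - κ) * Z := by
      have h1 := hNB n (by omega) hrn
      have h2 : R n ≤ (1 + B) * δ := by
        have h3 := mul_le_mul_of_nonneg_right hη1 (h.N_nonneg n)
        have h4 := h.N_nonneg n
        linarith
      rw [div_le_iff₀ han]
      calc R n ≤ (1 + B) * δ := h2
        _ ≤ (1 + B) * (J' ^ (1 - κ) * Z * a n) := by gcongr
        _ = _ := by ring
    have h1 := h.dist_le_source hν hp hβ ha hG hE
    have h2 := hwB (n + 1) hnk hrn'
    linarith

end IterationEstimates

end Recursion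

/-! ### The two discrepancy rules. -/

section Rules

variable {τ δ : ℝ} {r : ℕ → ℝ} {k : ℕ}

lemma existsUnique_isLeast {s : Set ℕ} (hs : s.Nonempty) : ∃! n, IsLeast s n :=
  ⟨sInf s, ⟨Nat.sInf_mem hs, fun _ hm => Nat.sInf_le hm⟩, fun _ hm =>
    hm.unique ⟨Nat.sInf_mem hs, fun _ hm => Nat.sInf_le hm⟩⟩

lemma existsUnique_stopping {c : ℝ} {t : ℝ} {s : Set ℕ} (h : t ≤ c ∨ s.Nonempty) :
    ∃! n, (t ≤ c ∧ n = 0) ∨ (c < t ∧ IsLeast s n) := by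
  rcases le_or_gt t c with htc | htc
  · exact ⟨0, Or.inl ⟨htc, rfl⟩, fun n hn => hn.elim (fun h => h.2) fun h => absurd htc h.1.not_ge⟩
  · obtain ⟨n, hn, huniq⟩ := existsUnique_isLeast (h.resolve_left htc.not_ge)
    exact ⟨n, Or.inr ⟨htc, hn⟩, fun m hm =>
      hm.elim (fun h => absurd h.1 htc.not_ge) fun h => huniq m h.2⟩

lemma existsUnique_averageRule
    (h : r 0 ≤ τ * δ ∨ (2 ≤ k ∧ r k ≤ τ * δ ∧ r (k - 1) ≤ τ * δ)) :
    ∃! n, AverageRule τ δ r n :=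
  existsUnique_stopping (h.imp_right fun h => ⟨k, by omega, by linarith [h.2.1, h.2.2]⟩)

lemma existsUnique_maxRule
    (h : r 0 ≤ τ * δ ∨ (2 ≤ k ∧ r k ≤ τ * δ ∧ r (k - 1) ≤ τ * δ)) :
    ∃! n, MaxRule τ δ r n :=
  existsUnique_stopping (h.imp_right fun h => ⟨k, h.1, max_le h.2.1 h.2.2⟩)

/-- What is used of the two discrepancy rules for the convergence rate. -/
lemma stopping_cases (hτδ : 0 ≤ τ * δ) (hr : ∀ n, 0 ≤ r n)
    (h : r 0 ≤ τ * δ ∨ (2 ≤ k ∧ r k ≤ τ * δ ∧ r (k - 1) ≤ τ * δ)) {n : ℕ}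
    (hn : AverageRule τ δ r n ∨ MaxRule τ δ r n) :
    (r 0 ≤ τ * δ ∧ n = 0) ∨ ∃ m, n = m + 1 ∧ m + 1 ≤ k ∧ (∃ j ≤ m, m ≤ j + 1 ∧ τ * δ < r j) ∧
      r m ≤ 2 * τ * δ ∧ r (m + 1) ≤ 2 * τ * δ := by
  rcases le_or_gt (r 0) (τ * δ) with h0 | h0
  · left
    refine ⟨h0, ?_⟩
    rcases hn with (h1 | h1) | (h1 | h1)
    · exact h1.2
    · exact absurd h0 h1.1.not_ge
    · exact h1.2
    · exact absurd h0 h1.1.not_ge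
  · right
    obtain ⟨hk2, hk, hk'⟩ := h.resolve_left h0.not_ge
    rcases hn with (h1 | ⟨-, ⟨h1, h2⟩, h3⟩) | (h1 | ⟨-, ⟨h1, h2⟩, h3⟩)
    · exact absurd h1.1 h0.not_ge
    · obtain ⟨m, rfl⟩ : ∃ m, n = m + 1 := ⟨n - 1, by omega⟩
      rw [Nat.add_sub_cancel] at h2
      refine ⟨m, rfl, h3 ⟨by omega, by linarith⟩, ?_, by linarith [hr (m + 1)],
        by linarith [hr m]⟩
      -- For m = 0 the large discrepancy is r_0. Otherwise, if r_m and r_{m−1} were both at most τδ,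
      -- so would be their average, and the rule would have stopped earlier.
      rcases m with _ | m
      · exact ⟨0, le_rfl, by omega, h0⟩
      · by_contra! hcon
        have h4 := hcon (m + 1) le_rfl (by omega)
        have h5 := hcon m (by omega) le_rfl
        have := h3 (show m + 1 ∈ _ from ⟨by omega, by rw [Nat.add_sub_cancel]; linarith⟩)
        omega
    · exact absurd h1.1 h0.not_ge
    · obtain ⟨m, rfl⟩ : ∃ m, n = m + 1 := ⟨n - 1, by omega⟩
      rw [Nat.add_sub_cancel, max_le_iff] at h2
      refine ⟨m, rfl, h3 ⟨hk2, max_le hk hk'⟩, ?_, by linarith, by linarith⟩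
      obtain ⟨m, rfl⟩ : ∃ l, m = l + 1 := ⟨m - 1, by omega⟩
      -- Stopping at index 2 says nothing about index 1, which the maximum rule does not test; there
      -- r_0 > τδ is used.
      rcases m with _ | m
      · exact ⟨0, by omega, by omega, h0⟩
      · by_contra! hcon
        have h4 := hcon (m + 1 + 1) le_rfl (by omega)
        have h5 := hcon (m + 1) (by omega) le_rfl
        have := h3 (show m + 1 + 1 ∈ _ from ⟨by omega, max_le h4 h5⟩)
        omega

end Rules

/-! ### Minimizers, subgradients and the restriction to a convex set. -/

section Convex

variable {X : Type*} [NormedAddCommGroup X] [NormedSpace ℝ X]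

/-- The function `f` with effective domain `D` is `p`-convex with constant `C₀` and lower
semi-continuous. -/
structure IsClosedPConvexOn (p C₀ : ℝ) (D : Set X) (f : X → ℝ) : Prop where
  convex : ∀ x ∈ D, ∀ z ∈ D, ∀ l : ℝ, 0 < l → l < 1 → l • z + (1 - l) • x ∈ D ∧
    f (l • z + (1 - l) • x) + C₀ * l * (1 - l) * ‖z - x‖ ^ p ≤ l * f z + (1 - l) * f x
  closed : ∀ (u : ℕ → X) (a : X) (c : ℝ), (∀ n, u n ∈ D) → Tendsto u atTop (𝓝 a) →
    (∀ ε > 0, ∀ᶠ n in atTop, f (u n) ≤ c + ε) → a ∈ D ∧ f a ≤ c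

namespace IsClosedPConvexOn

variable {p C₀ : ℝ} {D : Set X} {f : X → ℝ}

lemma add_convex (h : IsClosedPConvexOn p C₀ D f) {g : X → ℝ} (hg : Continuous g)
    (hgc : ConvexOn ℝ Set.univ g) : IsClosedPConvexOn p C₀ D (fun x => f x + g x) where
  convex x hx z hz l hl hl1 := by
    obtain ⟨h1, h2⟩ := h.convex x hx z hz l hl hl1
    refine ⟨h1, ?_⟩
    have h3 := hgc.2 (Set.mem_univ z) (Set.mem_univ x) hl.le (sub_nonneg.2 hl1.le) (by ring)
    simp only [smul_eq_mul] at h3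
    linarith
  closed u a c hu hua hc := by
    have h1 : Tendsto (fun n => g (u n)) atTop (𝓝 (g a)) := (hg.tendsto a).comp hua
    have h2 := h.closed u a (c - g a) hu hua fun ε hε => by
      filter_upwards [hc (ε / 2) (by linarith),
        h1.eventually (lt_mem_nhds (show g a - ε / 2 < g a by linarith))] with n h3 h4
      linarith
    exact ⟨h2.1, by linarith [h2.2]⟩

lemma inter (h : IsClosedPConvexOn p C₀ D f) {s : Set X} (hs : IsClosed s) (hsc : Convex ℝ s) :
    IsClosedPConvexOn p C₀ (D ∩ s) f where
  convex x hx z hz l hl hl1 := by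
    obtain ⟨h1, h2⟩ := h.convex x hx.1 z hz.1 l hl hl1
    exact ⟨⟨h1, hsc hz.2 hx.2 hl.le (sub_nonneg.2 hl1.le) (by ring)⟩, h2⟩
  closed u a c hu hua hc := by
    obtain ⟨h1, h2⟩ := h.closed u a c (fun n => (hu n).1) hua hc
    exact ⟨⟨h1, hs.mem_of_tendsto hua (Eventually.of_forall fun n => (hu n).2)⟩, h2⟩

/-- `p`-convexity at midpoints makes every minimizing sequence Cauchy, so completeness and lower
semicontinuity suffice; no reflexivity is needed. -/
lemma exists_minimizer [CompleteSpace X] (h : IsClosedPConvexOn p C₀ D f) (hp : 0 < p)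
    (hC : 0 < C₀) (hD : D.Nonempty) {B : ℝ} (hB : ∀ x ∈ D, B ≤ f x) :
    ∃ x ∈ D, ∀ z ∈ D, f x ≤ f z := by
  have hbdd : BddBelow (f '' D) := ⟨B, by rintro _ ⟨x, hx, rfl⟩; exact hB x hx⟩
  set m := sInf (f '' D) with hm
  have hmle : ∀ x ∈ D, m ≤ f x := fun x hx => csInf_le hbdd ⟨x, hx, rfl⟩
  have hex : ∀ n : ℕ, ∃ x ∈ D, f x < m + 1 / ((n : ℝ) + 1) := fun n => by
    obtain ⟨_, ⟨x, hx, rfl⟩, hlt⟩ := exists_lt_of_csInf_lt (hD.image f)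
      (show m < m + 1 / ((n : ℝ) + 1) from lt_add_of_pos_right _ Nat.one_div_pos_of_nat)
    exact ⟨x, hx, hlt⟩
  choose u hu hum using hex
  have hcauchy : CauchySeq u := by
    refine cauchySeq_of_le_tendsto_0 (fun n : ℕ => (4 / C₀ * (1 / ((n : ℝ) + 1))) ^ (1 / p))
      (fun n k N hn hk => ?_) ?_
    · have h1 := (h.convex (u k) (hu k) (u n) (hu n) (1 / 2) (by norm_num) (by norm_num))
      have h2 := hmle _ h1.1
      have hle : ∀ j : ℕ, N ≤ j → 1 / ((j : ℝ) + 1) ≤ 1 / ((N : ℝ) + 1) := fun j hj =>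
        Nat.one_div_le_one_div hj
      have h3 : ‖u n - u k‖ ^ p ≤ 4 / C₀ * (1 / ((N : ℝ) + 1)) := by
        rw [div_mul_eq_mul_div, le_div_iff₀ hC]
        linarith [h1.2, hum n, hum k, hle n hn, hle k hk]
      rw [dist_eq_norm]
      calc ‖u n - u k‖ = (‖u n - u k‖ ^ p) ^ (1 / p) := by
            rw [← Real.rpow_mul (norm_nonneg _), mul_one_div_cancel hp.ne', Real.rpow_one]
        _ ≤ _ := Real.rpow_le_rpow (Real.rpow_nonneg (norm_nonneg _) _) h3 (by positivity)
    · have h1 : Tendsto (fun n : ℕ => 4 / C₀ * (1 / ((n : ℝ) + 1))) atTop (𝓝 (4 / C₀ * 0)) :=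
        tendsto_one_div_add_atTop_nhds_zero_nat.const_mul _
      have h2 := h1.rpow_const (p := 1 / p) (Or.inr (by positivity))
      rwa [mul_zero, Real.zero_rpow (by positivity)] at h2
  obtain ⟨a, ha⟩ := cauchySeq_tendsto_of_complete hcauchy
  obtain ⟨h1, h2⟩ := h.closed u a m hu ha fun ε hε => by
    filter_upwards [tendsto_one_div_add_atTop_nhds_zero_nat.eventually (gt_mem_nhds hε)] with n hn
    linarith [hum n]
  exact ⟨a, h1, fun z hz => h2.trans (hmle z hz)⟩

lemma convexOn (h : IsClosedPConvexOn p C₀ D f) (hC : 0 ≤ C₀) : ConvexOn ℝ D f := by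
  have key : ∀ x ∈ D, ∀ z ∈ D, ∀ l : ℝ, 0 < l → l < 1 → l • z + (1 - l) • x ∈ D ∧
      f (l • z + (1 - l) • x) ≤ l * f z + (1 - l) * f x := fun x hx z hz l hl hl1 => by
    obtain ⟨h1, h2⟩ := h.convex x hx z hz l hl hl1
    have h3 : 0 ≤ C₀ * l * (1 - l) * ‖z - x‖ ^ p := by
      have := sub_nonneg.2 hl1.le
      positivity
    exact ⟨h1, by linarith⟩
  refine convexOn_iff_forall_pos.2 ⟨convex_iff_forall_pos.2 fun z hz x hx s t hs ht hst => ?_,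
    fun z hz x hx s t hs ht hst => ?_⟩ <;>
  · obtain rfl : t = 1 - s := by linarith
    have := key x hx z hz s hs (by linarith)
    first | exact this.1 | exact this.2

end IsClosedPConvexOn

/-- The sum rule for subgradients at a minimizer of the sum of a convex function on `D` and a
continuous convex function. -/
lemma exists_subgradient_of_minimizer {D : Set X} {f g : X → ℝ} (hf : ConvexOn ℝ D f)
    (hg : ConvexOn ℝ Set.univ g) (hgc : Continuous g) {x : X} (hx : x ∈ D)
    (hmin : ∀ z ∈ D, f x + g x ≤ f z + g z) :
    ∃ ξ : StrongDual ℝ X, (∀ z ∈ D, f x + ξ (z - x) ≤ f z) ∧ ∀ z, g x - ξ (z - x) ≤ g z := by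
  -- Minimality says that this open hypograph misses the epigraph of f; the slope of a separating
  -- hyperplane is the subgradient.
  have hA : Convex ℝ {q : X × ℝ | q.2 < g x + f x - g q.1} := by
    have h1 : ConcaveOn ℝ Set.univ fun z => g x + f x - g z :=
      (concaveOn_const _ convex_univ).sub hg
    have h2 := h1.convex_strict_hypograph
    simpa using h2
  have hAo : IsOpen {q : X × ℝ | q.2 < g x + f x - g q.1} :=
    isOpen_lt continuous_snd (by fun_prop)
  have hdisj : Disjoint {q : X × ℝ | q.2 < g x + f x - g q.1}
      {q : X × ℝ | q.1 ∈ D ∧ f q.1 ≤ q.2} := by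
    rw [Set.disjoint_left]
    rintro ⟨z, t⟩ h1 ⟨h2, h3⟩
    have := hmin z h2
    simp only [Set.mem_ofPred_eq] at h1 h3
    linarith
  obtain ⟨φ, u, hu1, hu2⟩ := geometric_hahn_banach_open hA hAo hf.convex_epigraph hdisj
  set c := φ (0, 1) with hc
  have hφ : ∀ z t, φ (z, t) = φ (z, 0) + t * c := fun z t => by
    have : ((z, t) : X × ℝ) = (z, 0) + t • ((0 : X), (1 : ℝ)) := by simp
    rw [this, map_add, map_smul, smul_eq_mul]
  have hux : u ≤ φ (x, 0) + f x * c := by rw [← hφ]; exact hu2 _ ⟨hx, le_rfl⟩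
  -- The hyperplane is not vertical: points just below (x, f x) lie in the open set.
  have hc0 : 0 < c := by
    have h1 := hu1 (x, f x - 1) (by simp)
    rw [hφ] at h1
    linarith
  have hlim : ∀ z, φ (z, 0) + (g x + f x - g z) * c ≤ u := fun z => by
    by_contra! hlt
    obtain ⟨t, ht0, ht⟩ : ∃ t, 0 < t ∧ t * c < φ (z, 0) + (g x + f x - g z) * c - u :=
      ⟨(φ (z, 0) + (g x + f x - g z) * c - u) / 2 / c, div_pos (by linarith) hc0, by
        rw [div_mul_cancel₀ _ hc0.ne']; linarith⟩
    have h1 := hu1 (z, g x + f x - g z - t) (by simp only [Set.mem_ofPred_eq]; linarith)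
    rw [hφ] at h1
    linarith
  have hlin : ∀ z, φ (z - x, 0) = φ (z, 0) - φ (x, 0) := fun z => by
    rw [← map_sub]; simp
  refine ⟨-(c⁻¹ • φ.comp (ContinuousLinearMap.inl ℝ X ℝ)), fun z hz => ?_, fun z => ?_⟩
  · have h1 : u ≤ φ (z, 0) + f z * c := by rw [← hφ]; exact hu2 _ ⟨hz, le_rfl⟩
    have h2 := hlim x
    simp only [neg_apply, smul_apply,
      ContinuousLinearMap.comp_apply, ContinuousLinearMap.inl_apply, smul_eq_mul, hlin]
    have h3 : f x - f z ≤ c⁻¹ * (φ (z, 0) - φ (x, 0)) := by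
      rw [inv_mul_eq_div, le_div_iff₀ hc0]; linarith
    linarith
  · have h2 := hlim z
    simp only [neg_apply, smul_apply,
      ContinuousLinearMap.comp_apply, ContinuousLinearMap.inl_apply, smul_eq_mul, hlin]
    have h3 : c⁻¹ * (φ (z, 0) - φ (x, 0)) ≤ g z - g x := by
      rw [inv_mul_eq_div, div_le_iff₀ hc0]; linarith
    linarith

/-- The bound of `PConvexBound` for points in the segment between two points of the domain. -/
lemma IsClosedPConvexOn.segment_bound [CompleteSpace X] {p C₀ γ : ℝ} {D : Set X} {f : X → ℝ}
    (h : IsClosedPConvexOn p C₀ D f) (hp : 0 < p) (hC : 0 < C₀)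
    (hγ : ∀ x ∈ D, ∀ ξ : StrongDual ℝ X, (∀ z ∈ D, f x + ξ (z - x) ≤ f z) →
      ∀ z ∈ D, ‖z - x‖ ^ p ≤ γ * (f z - f x - ξ (z - x)))
    (hγ0 : 0 < γ) {x₁ : X} {ξ₁ : StrongDual ℝ X} (hξ₁ : ∀ z ∈ D, f x₁ + ξ₁ (z - x₁) ≤ f z)
    {x z : X} (hx : x ∈ D) (hz : z ∈ D) {l : ℝ} (hl : 0 < l) (hl1 : l < 1) :
    f (l • z + (1 - l) • x) + γ⁻¹ * l * (1 - l) ^ p * ‖z - x‖ ^ p ≤ l * f z + (1 - l) * f x := by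
  set u := l • z + (1 - l) • x with hu
  have huD : u ∈ D := (h.convex x hx z hz l hl hl1).1
  set m := f x₁ + ξ₁ (u - x₁) with hm
  have hlow : ∀ w ∈ D, m - ‖ξ₁‖ * ‖w - u‖ ≤ f w := fun w hw => by
    have h1 := hξ₁ w hw
    have h2 : ξ₁ (w - x₁) = ξ₁ (u - x₁) + ξ₁ (w - u) := by rw [← map_add]; congr 1; abel
    have h3 := (abs_le.1 (ξ₁.le_opNorm (w - u))).1
    linarith
  have hnc : ∀ k : ℝ, 0 ≤ k → ConvexOn ℝ Set.univ fun w : X => k * ‖w - u‖ := fun k hk => by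
    have h1 : ConvexOn ℝ Set.univ fun w : X => ‖w + -u‖ :=
      (convexOn_univ_norm (E := X)).translate_left (-u) |>.subset (Set.subset_univ _) convex_univ
    simpa [sub_eq_add_neg] using h1.smul hk
  -- The point u may have no subgradient, so it is approximated by minimizers w of f plus a steep
  -- multiple of ‖· − u‖, which do. The slope must exceed ‖ξ₁‖, since the affine minorant of f may
  -- decrease at that rate; the excess n + 1 forces w → u. The subgradient at w is nonnegative on u
  -- − w, so it drops out of the convex combination.
  have hex : ∀ n : ℕ, ∃ w ∈ D, (n + 1) * ‖w - u‖ ≤ f u - m ∧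
      f w + γ⁻¹ * l * ‖z - w‖ ^ p ≤ l * f z + (1 - l) * f x := fun n => by
    have hk : 0 ≤ ‖ξ₁‖ + n + 1 := by positivity
    have hcont : Continuous fun w : X => (‖ξ₁‖ + n + 1) * ‖w - u‖ := by fun_prop
    obtain ⟨w, hw, hwmin⟩ := (h.add_convex hcont (hnc _ hk)).exists_minimizer hp hC ⟨u, huD⟩
      (B := m) (fun w hw => by
        have h1 := hlow w hw
        have h2 : 0 ≤ ((n : ℝ) + 1) * ‖w - u‖ := by positivity
        linarith)
    obtain ⟨ξ, hξ1, hξ2⟩ := exists_subgradient_of_minimizer (h.convexOn hC.le) (hnc _ hk) hcont hw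
      hwmin
    refine ⟨w, hw, ?_, ?_⟩
    · have h1 := hlow w hw
      have h2 := hwmin u huD
      simp only [sub_self, norm_zero, mul_zero, add_zero] at h2
      linarith
    · have h1 := hξ2 u
      simp only [sub_self, norm_zero, mul_zero] at h1
      have h0 : 0 ≤ (‖ξ₁‖ + n + 1) * ‖w - u‖ := by positivity
      have h2 : ξ (u - w) = l * ξ (z - w) + (1 - l) * ξ (x - w) := by
        rw [← smul_eq_mul, ← smul_eq_mul, ← map_smul, ← map_smul, ← map_add]
        congr 1
        rw [hu]
        module
      have h3 := hγ w hw ξ hξ1 z hz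
      have h4 := hξ1 x hx
      rw [← inv_mul_le_iff₀ hγ0] at h3
      have h5 := mul_le_mul_of_nonneg_left h3 hl.le
      have h6 := mul_le_mul_of_nonneg_left h4 (sub_nonneg.2 hl1.le)
      linarith
  choose w hwD hw1 hw2 using hex
  have hlim : Tendsto w atTop (𝓝 u) := by
    rw [tendsto_iff_norm_sub_tendsto_zero]
    have h1 : Tendsto (fun n : ℕ => (f u - m) * (1 / ((n : ℝ) + 1))) atTop (𝓝 ((f u - m) * 0)) :=
      tendsto_one_div_add_atTop_nhds_zero_nat.const_mul _
    rw [mul_zero] at h1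
    refine squeeze_zero (fun n => norm_nonneg _) (fun n => ?_) h1
    rw [mul_one_div, le_div_iff₀ (by positivity)]
    linarith [hw1 n]
  have hG : Tendsto (fun n => γ⁻¹ * l * ‖z - w n‖ ^ p) atTop (𝓝 (γ⁻¹ * l * ‖z - u‖ ^ p)) :=
    ((tendsto_const_nhds.sub hlim).norm.rpow_const (Or.inr hp.le)).const_mul _
  have hres := (h.closed w u (l * f z + (1 - l) * f x - γ⁻¹ * l * ‖z - u‖ ^ p) hwD hlim
    fun ε hε => by
      filter_upwards [hG.eventually (lt_mem_nhds
        (show γ⁻¹ * l * ‖z - u‖ ^ p - ε < γ⁻¹ * l * ‖z - u‖ ^ p by linarith))] with n hn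
      linarith [hw2 n]).2
  have hzu : z - u = (1 - l) • (z - x) := by rw [hu]; module
  rw [hzu, norm_smul, Real.norm_of_nonneg (sub_nonneg.2 hl1.le),
    Real.mul_rpow (sub_nonneg.2 hl1.le) (norm_nonneg _)] at hres
  linarith

/-- A lower bound for the growth above one subgradient that holds at all subgradients of `f` on
`D` holds for the subgradients of the restriction of `f` to a convex set. -/
lemma IsClosedPConvexOn.restrict_bound [CompleteSpace X] {p C₀ γ : ℝ} {D s : Set X} {f : X → ℝ}
    (h : IsClosedPConvexOn p C₀ D f) (hp : 0 < p) (hC : 0 < C₀)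
    (hγ : ∀ x ∈ D, ∀ ξ : StrongDual ℝ X, (∀ z ∈ D, f x + ξ (z - x) ≤ f z) →
      ∀ z ∈ D, ‖z - x‖ ^ p ≤ γ * (f z - f x - ξ (z - x)))
    (hγ0 : 0 < γ) {x₁ : X} {ξ₁ : StrongDual ℝ X} (hξ₁ : ∀ z ∈ D, f x₁ + ξ₁ (z - x₁) ≤ f z)
    (hs : Convex ℝ s) {x : X} (hx : x ∈ D ∩ s) {ξ : StrongDual ℝ X}
    (hξ : ∀ z ∈ D ∩ s, f x + ξ (z - x) ≤ f z) {z : X} (hz : z ∈ D ∩ s) :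
    ‖z - x‖ ^ p ≤ γ * (f z - f x - ξ (z - x)) := by
  -- The restricted subgradient bounds f from below on the segment; combined with `segment_bound`
  -- and divided by l, this gives the claim as l → 0.
  have key : ∀ᶠ l : ℝ in 𝓝[>] 0, γ⁻¹ * (1 - l) ^ p * ‖z - x‖ ^ p ≤ f z - f x - ξ (z - x) := by
    filter_upwards [Ioo_mem_nhdsGT (zero_lt_one (α := ℝ))] with l hl
    have h1 := h.segment_bound hp hC hγ hγ0 hξ₁ hx.1 hz.1 hl.1 hl.2
    have h2 := hξ (l • z + (1 - l) • x) ⟨(h.convex x hx.1 z hz.1 l hl.1 hl.2).1,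
      hs hz.2 hx.2 hl.1.le (sub_nonneg.2 hl.2.le) (by ring)⟩
    have h3 : l • z + (1 - l) • x - x = l • (z - x) := by module
    rw [h3, map_smul, smul_eq_mul] at h2
    have h4 : l * (γ⁻¹ * (1 - l) ^ p * ‖z - x‖ ^ p) ≤ l * (f z - f x - ξ (z - x)) := by linarith
    exact le_of_mul_le_mul_left h4 hl.1
  have hlim : Tendsto (fun l : ℝ => γ⁻¹ * (1 - l) ^ p * ‖z - x‖ ^ p) (𝓝[>] 0)
      (𝓝 (γ⁻¹ * (1 - 0) ^ p * ‖z - x‖ ^ p)) := by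
    refine Tendsto.mono_left ?_ nhdsWithin_le_nhds
    exact (((tendsto_const_nhds.sub tendsto_id).rpow_const (Or.inr hp.le)).const_mul _).mul_const _
  have h1 := le_of_tendsto hlim key
  rw [sub_zero, Real.one_rpow, mul_one] at h1
  rwa [inv_mul_le_iff₀ hγ0] at h1

end Convex

/-! ### Passage from extended real values to real values. -/

section EffDomain

variable {X : Type*} {Ψ : X → EReal}

lemma coe_toReal_of_mem_effDomain (hbot : ∀ x, Ψ x ≠ ⊥) {x : X} (hx : x ∈ effDomain Ψ) :
    ((Ψ x).toReal : EReal) = Ψ x :=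
  EReal.coe_toReal hx (hbot x)

lemma restrictTo_of_mem (Θ : X → EReal) {s : Set X} {x : X} (hx : x ∈ s) :
    restrictTo Θ s x = Θ x := by
  simp [restrictTo, hx]

lemma restrictTo_of_notMem {Θ : X → EReal} (hbot : ∀ x, Θ x ≠ ⊥) {s : Set X} {x : X}
    (hx : x ∉ s) : restrictTo Θ s x = ⊤ := by
  simp [restrictTo, hx, EReal.add_top_of_ne_bot (hbot x)]

lemma restrictTo_ne_bot {Θ : X → EReal} (hbot : ∀ x, Θ x ≠ ⊥) (s : Set X) (x : X) :
    restrictTo Θ s x ≠ ⊥ := by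
  by_cases hx : x ∈ s
  · rw [restrictTo_of_mem Θ hx]; exact hbot x
  · rw [restrictTo_of_notMem hbot hx]; exact top_ne_bot

lemma effDomain_restrictTo {Θ : X → EReal} (hbot : ∀ x, Θ x ≠ ⊥) (s : Set X) :
    effDomain (restrictTo Θ s) = effDomain Θ ∩ s := by
  ext x
  by_cases hx : x ∈ s
  · simp [effDomain, restrictTo_of_mem Θ hx, hx]
  · simp [effDomain, restrictTo_of_notMem hbot hx, hx]

end EffDomain

section Convex

variable {X : Type*} [NormedAddCommGroup X] [NormedSpace ℝ X] {Ψ : X → EReal}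

lemma bregman_eq_coe (hbot : ∀ x, Ψ x ≠ ⊥) {x z : X} (hx : x ∈ effDomain Ψ)
    (hz : z ∈ effDomain Ψ) (ξ : StrongDual ℝ X) :
    bregman Ψ ξ z x = (((Ψ z).toReal - (Ψ x).toReal - ξ (z - x) : ℝ) : EReal) := by
  rw [bregman, ← coe_toReal_of_mem_effDomain hbot hx, ← coe_toReal_of_mem_effDomain hbot hz]
  norm_cast

lemma bregman_eq_top (hbot : ∀ x, Ψ x ≠ ⊥) {x z : X} (hx : x ∈ effDomain Ψ)
    (hz : z ∉ effDomain Ψ) (ξ : StrongDual ℝ X) : bregman Ψ ξ z x = ⊤ := by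
  have hz' : Ψ z = ⊤ := by simpa [effDomain] using hz
  rw [bregman, ← coe_toReal_of_mem_effDomain hbot hx, hz', EReal.top_sub_coe, EReal.top_sub_coe]

lemma mem_subdiff_iff (hbot : ∀ x, Ψ x ≠ ⊥) {x : X} (hx : x ∈ effDomain Ψ)
    {ξ : StrongDual ℝ X} :
    ξ ∈ subdiff Ψ x ↔ ∀ z ∈ effDomain Ψ, (Ψ x).toReal + ξ (z - x) ≤ (Ψ z).toReal := by
  refine ⟨fun h z hz => ?_, fun h z => ?_⟩
  · have h1 := h z
    rw [bregman_eq_coe hbot hx hz, EReal.coe_nonneg] at h1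
    linarith
  · by_cases hz : z ∈ effDomain Ψ
    · rw [bregman_eq_coe hbot hx hz, EReal.coe_nonneg]
      linarith [h z hz]
    · rw [bregman_eq_top hbot hx hz]
      exact le_top

lemma isClosedPConvexOn_toReal {p C₀ : ℝ} (hbot : ∀ x, Ψ x ≠ ⊥) (hlsc : LowerSemicontinuous Ψ)
    (hconv : ∀ (x z : X) (l : ℝ), 0 < l → l < 1 →
      Ψ (l • z + (1 - l) • x) + ((C₀ * l * (1 - l) * ‖z - x‖ ^ p : ℝ) : EReal)
        ≤ (l : EReal) * Ψ z + ((1 - l : ℝ) : EReal) * Ψ x) :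
    IsClosedPConvexOn p C₀ (effDomain Ψ) (fun x => (Ψ x).toReal) where
  convex x hx z hz l hl hl1 := by
    have h1 := hconv x z l hl hl1
    rw [← coe_toReal_of_mem_effDomain hbot hx, ← coe_toReal_of_mem_effDomain hbot hz,
      ← EReal.coe_mul, ← EReal.coe_mul, ← EReal.coe_add] at h1
    have hmem : l • z + (1 - l) • x ∈ effDomain Ψ := by
      intro htop
      rw [htop, EReal.top_add_coe] at h1
      exact absurd (top_le_iff.1 h1) (EReal.coe_ne_top _)
    refine ⟨hmem, ?_⟩
    rw [← coe_toReal_of_mem_effDomain hbot hmem, ← EReal.coe_add, EReal.coe_le_coe_iff] at h1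
    exact h1
  closed u a c hu hua hc := by
    have hle : Ψ a ≤ (c : EReal) := by
      by_contra! hlt
      obtain ⟨t, ht1, ht2⟩ := EReal.lt_iff_exists_real_btwn.1 hlt
      rw [EReal.coe_lt_coe_iff] at ht1
      obtain ⟨n, h1, h2⟩ := ((hc (t - c) (by linarith)).and
        (hua.eventually (hlsc a _ ht2))).exists
      rw [← coe_toReal_of_mem_effDomain hbot (hu n), gt_iff_lt, EReal.coe_lt_coe_iff] at h2
      linarith
    have ha : a ∈ effDomain Ψ := fun htop => by
      rw [htop] at hle
      exact absurd (top_le_iff.1 hle) (EReal.coe_ne_top _)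
    refine ⟨ha, ?_⟩
    rwa [← coe_toReal_of_mem_effDomain hbot ha, EReal.coe_le_coe_iff] at hle

/-- The gradient of the Fenchel conjugate at `ξ` minimizes `Ψ - ξ`. -/
lemma IsDualGradientAt.le_toReal [CompleteSpace X] {p C₀ : ℝ} (hp : 0 < p) (hC : 0 < C₀)
    (hbot : ∀ x, Ψ x ≠ ⊥)
    (hΨ : IsClosedPConvexOn p C₀ (effDomain Ψ) (fun x => (Ψ x).toReal))
    (hne : (effDomain Ψ).Nonempty) {ξ : StrongDual ℝ X} {x : X}
    (h : IsDualGradientAt (fenchelConj Ψ) ξ x) :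
    x ∈ effDomain Ψ ∧ ∀ z ∈ effDomain Ψ, (Ψ x).toReal + ξ (z - x) ≤ (Ψ z).toReal := by
  obtain ⟨hfin, hder⟩ := h
  have hle : ∀ (η : StrongDual ℝ X), fenchelConj Ψ η ≠ ⊤ → ∀ z ∈ effDomain Ψ,
      η z - (Ψ z).toReal ≤ (fenchelConj Ψ η).toReal := fun η hη z hz => by
    have h1 : ((η z : ℝ) : EReal) - Ψ z ≤ fenchelConj Ψ η :=
      le_iSup (fun x : X => ((η x : ℝ) : EReal) - Ψ x) z
    rw [← coe_toReal_of_mem_effDomain hbot hz, ← EReal.coe_sub] at h1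
    have h2 : fenchelConj Ψ η ≠ ⊥ := fun hb => by
      rw [hb] at h1
      exact absurd (le_bot_iff.1 h1) (EReal.coe_ne_bot _)
    rwa [← EReal.coe_toReal hη h2, EReal.coe_le_coe_iff] at h1
  have hξ := hfin.self_of_nhds
  have hlin : ConvexOn ℝ Set.univ fun z => (-ξ) z := (-ξ).toLinearMap.convexOn convex_univ
  obtain ⟨w, hw, hwmin⟩ := (hΨ.add_convex (-ξ).continuous hlin).exists_minimizer hp hC hne
    (B := -(fenchelConj Ψ ξ).toReal) fun z hz => by
      have := hle ξ hξ.2 z hz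
      rw [neg_apply]
      linarith
  simp only [neg_apply] at hwmin
  have heq : (fenchelConj Ψ ξ).toReal = ξ w - (Ψ w).toReal := by
    refine le_antisymm ?_ (hle ξ hξ.2 w hw)
    have h1 : fenchelConj Ψ ξ ≤ ((ξ w - (Ψ w).toReal : ℝ) : EReal) := by
      refine iSup_le fun z => ?_
      by_cases hz : z ∈ effDomain Ψ
      · rw [← coe_toReal_of_mem_effDomain hbot hz, ← EReal.coe_sub, EReal.coe_le_coe_iff]
        linarith [hwmin z hz]
      · have hz' : Ψ z = ⊤ := by simpa [effDomain] using hz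
        rw [hz', EReal.sub_top]
        exact bot_le
    rwa [← EReal.coe_toReal hξ.2 hξ.1, EReal.coe_le_coe_iff] at h1
  -- The conjugate lies above the affine function attached to w and touches it at ξ, so its
  -- derivative there is evaluation at w.
  have hmin : IsLocalMin (fun η => (fenchelConj Ψ η).toReal -
      NormedSpace.inclusionInDoubleDual ℝ X w η) ξ := by
    filter_upwards [hfin] with η hη
    have h1 := hle η hη.2 w hw
    simp only [NormedSpace.dual_def]
    rw [heq]
    linarith
  have hzero := hmin.hasFDerivAt_eq_zero
    (hder.sub (NormedSpace.inclusionInDoubleDual ℝ X w).hasFDerivAt)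
  have hxw : x = w := by
    refine (SeparatingDual.eq_iff_forall_dual_eq (R := ℝ)).2 fun η => ?_
    have := DFunLike.congr_fun hzero η
    simp only [sub_apply, NormedSpace.dual_def, zero_apply] at this
    linarith
  rw [hxw]
  refine ⟨hw, fun z hz => ?_⟩
  have := hwmin z hz
  rw [map_sub]
  linarith

end Convex

/-! ### Linearization errors of F. -/

section Operator

variable {X Y : Type*} [NormedAddCommGroup X] [NormedSpace ℝ X]
  [NormedAddCommGroup Y] [NormedSpace ℝ Y]

/-- One-sided directional derivatives towards the points of a segment give a derivative along the
segment. -/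
lemma hasDerivWithinAt_segment {s : Set X} (hs : Convex ℝ s) {F : X → Y} {F' : X → X →L[ℝ] Y}
    (hF : ∀ x ∈ s, ∀ z ∈ s,
      Tendsto (fun t : ℝ => t⁻¹ • (F (x + t • (z - x)) - F x)) (𝓝[>] 0) (𝓝 (F' x (z - x))))
    {x z : X} (hx : x ∈ s) (hz : z ∈ s) {t : ℝ} (ht : t ∈ Set.Icc (0 : ℝ) 1) :
    HasDerivWithinAt (fun t : ℝ => F (x + t • (z - x))) (F' (x + t • (z - x)) (z - x))
      (Set.Icc 0 1) t := by
  have hmem : ∀ t ∈ Set.Icc (0 : ℝ) 1, x + t • (z - x) ∈ s := fun t ht =>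
    hs.add_smul_sub_mem hx hz ht
  -- The one-sided derivative towards the end e of the segment is rescaled to the parameter t; using
  -- e = 0 and e = 1 covers both sides, and linearity of F' makes the two values agree.
  have key : ∀ e ∈ Set.Icc (0 : ℝ) 1, e ≠ t →
      HasDerivWithinAt (fun t : ℝ => F (x + t • (z - x))) (F' (x + t • (z - x)) (z - x))
        {r | 0 ≤ (r - t) / (e - t)} t := fun e he het => by
    have het' : e - t ≠ 0 := sub_ne_zero.2 het
    set v := x + t • (z - x) with hv
    set w := x + e • (z - x) with hw
    have hwv : w - v = (e - t) • (z - x) := by rw [hw, hv]; module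
    have h1 : HasDerivWithinAt (fun h : ℝ => F (v + h • (w - v))) (F' v (w - v)) (Set.Ici 0) 0 := by
      rw [← hasDerivWithinAt_Ioi_iff_Ici, hasDerivWithinAt_iff_tendsto_slope' (by simp)]
      refine (hF v (hmem t ht) w (hmem e he)).congr fun h => ?_
      simp [slope_def_module]
    have h2 : HasDerivWithinAt (fun r : ℝ => (r - t) / (e - t)) (1 / (e - t))
        {r | 0 ≤ (r - t) / (e - t)} t :=
      (((hasDerivAt_id t).sub_const t).div_const (e - t)).hasDerivWithinAt
    have h3 := HasDerivWithinAt.scomp_of_eq t h1 h2 (fun r hr => hr) (by simp)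
    have h4 : (1 / (e - t)) • F' v (w - v) = F' v (z - x) := by
      rw [hwv, map_smul, smul_smul, one_div_mul_cancel het', one_smul]
    rw [h4] at h3
    refine h3.congr (fun r _ => ?_) ?_
    · simp only [Function.comp_apply]
      congr 1
      rw [hwv, smul_smul, div_mul_cancel₀ _ het', hv]
      module
    · simp only [Function.comp_apply, sub_self, zero_div, zero_smul, add_zero, hv]
  rcases ht.1.eq_or_lt with h0 | h0
  · have h1 := key 1 ⟨zero_le_one, le_rfl⟩ (by linarith)
    refine h1.mono fun r hr => ?_
    rw [← h0]
    simpa using hr.1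
  rcases ht.2.eq_or_lt with h1 | h1
  · have h1' := key 0 ⟨le_rfl, zero_le_one⟩ (by linarith)
    refine h1'.mono fun r hr => ?_
    simp only [Set.mem_ofPred_eq]
    exact div_nonneg_of_nonpos (by linarith [hr.2]) (by linarith)
  · have ha := key 1 ⟨zero_le_one, le_rfl⟩ (by linarith)
    have hb := key 0 ⟨le_rfl, zero_le_one⟩ (by linarith)
    refine (ha.union hb).mono fun r _ => ?_
    rcases le_total r t with hrt | hrt
    · exact Or.inr (show 0 ≤ (r - t) / (0 - t) from
        div_nonneg_of_nonpos (by linarith) (by linarith))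
    · exact Or.inl (show 0 ≤ (r - t) / (1 - t) from div_nonneg (by linarith) (by linarith))

namespace OperatorAssumption

variable {p γ : ℝ} {Θ : X → EReal} {α₀ : ℝ} {DF : Set X} {F : X → Y} {y : Y} {xd : X} {ρ : ℝ}
  {F' : X → X →L[ℝ] Y} {K₀ K₁ : ℝ}

lemma xd_mem (h : OperatorAssumption p γ Θ α₀ DF F y xd ρ F' K₀ K₁) :
    xd ∈ Metric.ball xd ρ ∩ DF :=
  ⟨Metric.mem_ball_self h.radius_pos, h.sol_mem_domain⟩

/-- Mean value inequality along the segment for F minus its linearization at x; the factor t from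
the nonlinearity condition is bounded by 1. -/
lemma linearization_error (h : OperatorAssumption p γ Θ α₀ DF F y xd ρ F' K₀ K₁) {x z : X}
    (hx : x ∈ Metric.ball xd ρ ∩ DF) (hz : z ∈ Metric.ball xd ρ ∩ DF) :
    ‖F z - F x - F' x (z - x)‖ ≤ (K₀ + K₁) * ‖z - x‖ * ‖F' x (z - x)‖ := by
  have hconv : Convex ℝ (Metric.ball xd ρ ∩ DF) := (convex_ball xd ρ).inter h.convex_domain
  have hder : ∀ t ∈ Set.Icc (0 : ℝ) 1,
      HasDerivWithinAt (fun t : ℝ => F (x + t • (z - x)) - t • F' x (z - x))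
        (F' (x + t • (z - x)) (z - x) - (1 : ℝ) • F' x (z - x)) (Set.Icc 0 1) t := fun t ht =>
    (hasDerivWithinAt_segment hconv h.derivative hx hz ht).sub
      ((hasDerivWithinAt_id t _).smul_const _)
  have hbound : ∀ t ∈ Set.Ico (0 : ℝ) 1,
      ‖F' (x + t • (z - x)) (z - x) - (1 : ℝ) • F' x (z - x)‖
        ≤ (K₀ + K₁) * ‖z - x‖ * ‖F' x (z - x)‖ := fun t ht => by
    have h1 := h.nonlinearity x hx _ (hconv.add_smul_sub_mem hx hz ⟨ht.1, ht.2.le⟩) (z - x)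
    rw [add_sub_cancel_left, map_smul, norm_smul, norm_smul, Real.norm_of_nonneg ht.1,
      sub_apply] at h1
    rw [one_smul]
    have h2 : t * (K₀ * ‖z - x‖ * ‖F' x (z - x)‖) ≤ K₀ * ‖z - x‖ * ‖F' x (z - x)‖ := by
      have := h.K₀_nonneg
      exact mul_le_of_le_one_left (by positivity) ht.2.le
    have h3 : t * (K₁ * ‖F' x (z - x)‖ * ‖z - x‖) ≤ K₁ * ‖F' x (z - x)‖ * ‖z - x‖ := by
      have := h.K₁_nonneg
      exact mul_le_of_le_one_left (by positivity) ht.2.le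
    linarith
  have h1 := norm_image_sub_le_of_norm_deriv_le_segment' hder hbound 1 ⟨zero_le_one, le_rfl⟩
  simp only [one_smul, zero_smul, add_zero, sub_zero, mul_one, add_sub_cancel] at h1
  rwa [sub_right_comm] at h1

lemma norm_derivative_le (h : OperatorAssumption p γ Θ α₀ DF F y xd ρ F' K₀ K₁) {x : X}
    (hx : x ∈ Metric.ball xd ρ ∩ DF) :
    ‖F' x (x - xd)‖ ≤ (1 + (K₀ + K₁) * ‖x - xd‖) * ‖F' xd (x - xd)‖ := by
  have h1 := h.nonlinearity xd h.xd_mem x hx (x - xd)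
  rw [sub_apply] at h1
  have h2 := norm_le_norm_add_norm_sub (F' xd (x - xd)) (F' x (x - xd))
  rw [norm_sub_rev] at h2
  linarith

lemma image_error (h : OperatorAssumption p γ Θ α₀ DF F y xd ρ F' K₀ K₁) {x : X}
    (hx : x ∈ Metric.ball xd ρ ∩ DF) :
    ‖F x - y - F' xd (x - xd)‖ ≤ (K₀ + K₁) * ‖x - xd‖ * ‖F' xd (x - xd)‖ := by
  have := h.linearization_error h.xd_mem hx
  rwa [h.sol_eq] at this

lemma solution_error (h : OperatorAssumption p γ Θ α₀ DF F y xd ρ F' K₀ K₁) {x : X}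
    (hx : x ∈ Metric.ball xd ρ ∩ DF) :
    ‖y - F x - F' x (xd - x)‖
      ≤ (K₀ + K₁) * ‖x - xd‖ * (1 + (K₀ + K₁) * ‖x - xd‖) * ‖F' xd (x - xd)‖ := by
  have h1 := h.linearization_error hx h.xd_mem
  have h2 : ‖F' x (xd - x)‖ = ‖F' x (x - xd)‖ := by rw [← neg_sub, map_neg, norm_neg]
  rw [h.sol_eq, norm_sub_rev xd x, h2] at h1
  refine h1.trans ?_
  rw [mul_assoc _ (1 + _)]
  have := h.K₀_nonneg
  have := h.K₁_nonneg
  have := h.norm_derivative_le hx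
  gcongr

lemma cross_error (h : OperatorAssumption p γ Θ α₀ DF F y xd ρ F' K₀ K₁) {x : X}
    (hx : x ∈ Metric.ball xd ρ ∩ DF) (w : X) :
    ‖F' x w - F' xd w‖
      ≤ K₀ * ‖x - xd‖ * ‖F' xd w‖ + K₁ * ‖w‖ * ‖F' xd (x - xd)‖ := by
  have h1 := h.nonlinearity xd h.xd_mem x hx w
  rw [sub_apply] at h1
  linarith

end OperatorAssumption

end Operator

/-! ### From the iterates to the scalar recursion. -/

section Iterates

variable {X Y : Type*} [NormedAddCommGroup X] [NormedSpace ℝ X]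
  [NormedAddCommGroup Y] [NormedSpace ℝ Y]

/-- Testing minimality with x† cancels x₀: the difference of the two penalties is the Bregman
distance at ξ† minus the pairing with ξ₀ − ξ†. -/
lemma step_inequality {p a : ℝ} {Ψ : X → EReal} (hbot : ∀ x, Ψ x ≠ ⊥) {F : X → Y}
    {F' : X → X →L[ℝ] Y} {yδ : Y} {ξ₀ ξd : StrongDual ℝ X} {x₀ xd u v : X} (ha : 0 < a)
    (hx₀ : x₀ ∈ effDomain Ψ) (hxd : xd ∈ effDomain Ψ)
    (hmin : IsMinOn (stepFunctional p Ψ F F' yδ ξ₀ x₀ a u) Set.univ v) :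
    v ∈ effDomain Ψ ∧ ‖yδ - F u - F' u (v - u)‖ ^ p + a * (bregman Ψ ξd v xd).toReal
      ≤ ‖yδ - F u - F' u (xd - u)‖ ^ p + a * (ξ₀ - ξd) (v - xd) := by
  have h1 : stepFunctional p Ψ F F' yδ ξ₀ x₀ a u v ≤ stepFunctional p Ψ F F' yδ ξ₀ x₀ a u xd :=
    hmin (Set.mem_univ xd)
  have hfin : ∀ w ∈ effDomain Ψ, stepFunctional p Ψ F F' yδ ξ₀ x₀ a u w
      = ((‖yδ - F u - F' u (w - u)‖ ^ p + a * ((Ψ w).toReal - (Ψ x₀).toReal - ξ₀ (w - x₀)) : ℝ) :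
          EReal) := fun w hw => by
    rw [stepFunctional, bregman_eq_coe hbot hx₀ hw]
    norm_cast
  have hv : v ∈ effDomain Ψ := by
    by_contra hv
    rw [hfin xd hxd, stepFunctional, bregman_eq_top hbot hx₀ hv,
      EReal.coe_mul_top_of_pos ha, EReal.coe_add_top] at h1
    exact absurd (top_le_iff.1 h1) (EReal.coe_ne_top _)
  refine ⟨hv, ?_⟩
  rw [hfin v hv, hfin xd hxd, EReal.coe_le_coe_iff] at h1
  rw [bregman_eq_coe hbot hxd hv, EReal.toReal_coe, sub_apply]
  simp only [map_sub] at h1 ⊢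
  linarith

/-- The iterates of the Gauss--Newton method satisfy the scalar inequalities of
`IterationEstimates`. -/
lemma IsIRGN.iterationEstimates [CompleteSpace X] {p γ ν : ℝ} (hp : 2 ≤ p) (hγ : 0 < γ)
    {Θ : X → EReal} {DF : Set X} {F : X → Y} {F' : X → X →L[ℝ] Y} {α : ℕ → ℝ} {y : Y} {xd : X}
    {ρ K₀ K₁ : ℝ} {ξ₀ ξd : StrongDual ℝ X} {x₀ : X} {β : ℝ} (hΘ : IsProper Θ)
    (hlsc : LowerSemicontinuous Θ) (hconv : IsPConvex p Θ) (hbound : PConvexBound p γ Θ)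
    (hα : ∀ n, 0 < α n) (hF : OperatorAssumption p γ Θ (α 0) DF F y xd ρ F' K₀ K₁)
    (hx₀ : IsDualGradientAt (fenchelConj (restrictTo Θ DF)) ξ₀ x₀)
    (hξd : ξd ∈ subdiff (restrictTo Θ DF) xd)
    (hsource : SourceCondition p ν β (restrictTo Θ DF) ξ₀ ξd xd (F' xd))
    {δ : ℝ} {yδ : Y} (hyδ : ‖yδ - y‖ ≤ δ) {x : ℕ → X}
    (hx : IsIRGN p (restrictTo Θ DF) DF F xd ρ F' α yδ ξ₀ x₀ x) :
    IterationEstimates p ν γ (γ ^ (1 / (p - 1)) * ‖ξ₀ - ξd‖ ^ (1 / (p - 1))) K₀ K₁ β ρ δ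
      (fun n => α n ^ (1 / p)) (fun n => ‖x n - xd‖)
      (fun n => (bregman (restrictTo Θ DF) ξd (x n) xd).toReal ^ (1 / p))
      (fun n => ‖F' xd (x n - xd)‖) (fun n => ‖F (x n) - yδ‖)
      (fun n => ‖yδ - F (x (n - 1)) - F' (x (n - 1)) (x n - x (n - 1))‖)
      (fun n => ‖yδ - F (x n) - F' (x n) (xd - x n)‖)
      (fun n => (ξ₀ - ξd) (x n - xd)) (fun n => x n ∈ effDomain (restrictTo Θ DF)) := by
  have hp0 : 0 < p := by linarith
  have hp1 : 0 < p - 1 := by linarith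
  set Ψ := restrictTo Θ DF with hΨ
  have hbot : ∀ x, Ψ x ≠ ⊥ := restrictTo_ne_bot hΘ.1 DF
  have hdom : effDomain Ψ = effDomain Θ ∩ DF := effDomain_restrictTo hΘ.1 DF
  have hΨΘ : ∀ z ∈ effDomain Ψ, (Ψ z).toReal = (Θ z).toReal := fun z hz => by
    rw [hdom] at hz
    rw [hΨ, restrictTo_of_mem Θ hz.2]
  obtain ⟨C₀, hC₀, hconv⟩ := hconv
  have hΘc := isClosedPConvexOn_toReal hΘ.1 hlsc hconv
  have hxd : xd ∈ effDomain Ψ := by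
    rw [hdom]; exact ⟨hF.sol_mem_subdiffDomain.1, hF.sol_mem_domain⟩
  have hξd' := (mem_subdiff_iff hbot hxd).1 hξd
  have hD0 : ∀ z, 0 ≤ (bregman Ψ ξd z xd).toReal := fun z => EReal.toReal_nonneg (hξd z)
  have hγp : 0 < γ ^ p := Real.rpow_pos_of_pos hγ p
  have hΘb : ∀ z ∈ effDomain Θ, ∀ ξ : StrongDual ℝ X,
      (∀ w ∈ effDomain Θ, (Θ z).toReal + ξ (w - z) ≤ (Θ w).toReal) →
      ∀ w ∈ effDomain Θ, ‖w - z‖ ^ p ≤ γ ^ p * ((Θ w).toReal - (Θ z).toReal - ξ (w - z)) := by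
    intro z hz ξ hξ w hw
    have hξ' := (mem_subdiff_iff hΘ.1 hz).2 hξ
    have h1 := hbound z ⟨hz, ξ, hξ'⟩ ξ hξ' w hw
    rw [bregman_eq_coe hΘ.1 hz hw, EReal.toReal_coe] at h1
    have h2 : 0 ≤ (Θ w).toReal - (Θ z).toReal - ξ (w - z) := by linarith [hξ w hw]
    have h3 := Real.rpow_le_rpow (norm_nonneg _) h1 hp0.le
    rwa [Real.mul_rpow hγ.le (Real.rpow_nonneg h2 _), ← Real.rpow_mul h2,
      one_div_mul_cancel hp0.ne', Real.rpow_one] at h3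
  have hdist : ∀ z ∈ effDomain Ψ, ‖z - xd‖ ≤ γ * (bregman Ψ ξd z xd).toReal ^ (1 / p) := by
    intro z hz
    obtain ⟨ξ₁, hξ₁⟩ := hF.sol_mem_subdiffDomain.2
    have h1 := hΘc.restrict_bound hp0 hC₀ hΘb hγp
      ((mem_subdiff_iff hΘ.1 hF.sol_mem_subdiffDomain.1).1 hξ₁) hF.convex_domain (hdom ▸ hxd)
      (ξ := ξd) (fun w hw => by
        rw [← hdom] at hw
        have := hξd' w hw
        rwa [hΨΘ w hw, hΨΘ xd hxd] at this) (hdom ▸ hz)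
    rw [← hΨΘ z hz, ← hΨΘ xd hxd] at h1
    have h2 : (bregman Ψ ξd z xd).toReal = (Ψ z).toReal - (Ψ xd).toReal - ξd (z - xd) := by
      rw [bregman_eq_coe hbot hxd hz, EReal.toReal_coe]
    rw [← h2] at h1
    have h3 := Real.rpow_le_rpow (by positivity) h1 (show 0 ≤ 1 / p by positivity)
    rwa [Real.mul_rpow hγp.le (hD0 z), ← Real.rpow_mul (norm_nonneg _), ← Real.rpow_mul hγ.le,
      mul_one_div_cancel hp0.ne', Real.rpow_one, Real.rpow_one] at h3
  obtain ⟨hx₀dom, hx₀min⟩ := IsDualGradientAt.le_toReal hp0 hC₀ hbot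
    (by
      rw [hdom]
      have h1 := hΘc.inter hF.isClosed_domain hF.convex_domain
      refine ⟨fun a ha b hb l hl hl1 => ?_, fun u a c hu hua hc => ?_⟩
      · obtain ⟨h2, h3⟩ := h1.convex a ha b hb l hl hl1
        refine ⟨h2, ?_⟩
        rw [hΨΘ _ (hdom ▸ h2), hΨΘ _ (hdom ▸ hb), hΨΘ _ (hdom ▸ ha)]
        exact h3
      · obtain ⟨h2, h3⟩ := h1.closed u a c hu hua fun ε hε => by
          filter_upwards [hc ε hε] with n hn
          rwa [← hΨΘ _ (hdom ▸ hu n)]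
        exact ⟨h2, by rwa [hΨΘ _ (hdom ▸ h2)]⟩) ⟨xd, hxd⟩ hx₀
  have hpow : ∀ t : ℝ, 0 ≤ t → (t ^ (1 / p)) ^ p = t := fun t ht => by
    rw [← Real.rpow_mul ht, one_div_mul_cancel hp0.ne', Real.rpow_one]
  have hmem : ∀ n, x n ∈ effDomain Ψ → ‖x n - xd‖ < ρ → x n ∈ Metric.ball xd ρ ∩ DF :=
    fun n h1 h2 => ⟨by rwa [mem_ball_iff_norm], by rw [hdom] at h1; exact h1.2⟩
  have hstep : ∀ n, x n ∈ effDomain Ψ → ‖x n - xd‖ < ρ → _ := fun n h1 h2 =>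
    step_inequality (ξd := ξd) hbot (hα n) hx₀dom hxd (hx.2 n (hmem n h1 h2))
  refine
    { E_nonneg := fun n => norm_nonneg _
      d_nonneg := fun n => Real.rpow_nonneg (hD0 _) _
      N_nonneg := fun n => norm_nonneg _
      Q_nonneg := fun n => norm_nonneg _
      R_nonneg := fun n => norm_nonneg _
      init_mem := hx.1 ▸ hx₀dom
      init_le := ?_
      init_image_le := ?_
      dist_le := fun n hn => hdist _ hn
      pairing_le := fun n hn => ?_
      source_le := fun n hn => ?_
      step_mem := fun n h1 h2 => (hstep n h1 h2).1
      step_le := fun n h1 h2 => ?_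
      solution_resid_le := fun n h1 h2 => ?_
      discrepancy_le := fun n h1 h2 => ?_
      image_le := fun n h1 h2 => ?_
      image_succ_le := fun n h1 h2 h3 => ?_
      discrepancy_succ_le := fun n h1 h2 h3 => ?_ }
  -- As ξ₀ is a subgradient at x₀, the Bregman distance of x₀ to x† is at most the pairing.
  · rw [hpow _ (hD0 _), hx.1, bregman_eq_coe hbot hxd hx₀dom, EReal.toReal_coe, sub_apply]
    have := hx₀min xd hxd
    simp only [map_sub] at this ⊢
    linarith
  · exact (F' xd).le_of_opNorm_le hF.scaling _
  · have h1 : (γ ^ (1 / (p - 1)) * ‖ξ₀ - ξd‖ ^ (1 / (p - 1))) ^ (p - 1) = γ * ‖ξ₀ - ξd‖ := by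
      rw [Real.mul_rpow (by positivity) (by positivity), ← Real.rpow_mul hγ.le,
        ← Real.rpow_mul (norm_nonneg _), one_div_mul_cancel hp1.ne', Real.rpow_one, Real.rpow_one]
    have h2 := (Real.le_norm_self _).trans ((ξ₀ - ξd).le_opNorm (x n - xd))
    have h3 := mul_le_mul_of_nonneg_left (hdist _ hn) (norm_nonneg (ξ₀ - ξd))
    rw [h1]
    linarith
  · have h1 := hsource (x n) hn
    have h2 : ((bregman Ψ ξd (x n) xd).toReal ^ (1 / p)) ^ (1 - ν)
        = (bregman Ψ ξd (x n) xd).toReal ^ ((1 - ν) / p) := by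
      rw [← Real.rpow_mul (hD0 _), one_div_mul_eq_div]
    rwa [h2]
  · have h3 := (hstep n h1 h2).2
    rw [hpow _ (hD0 _), hpow _ (hα n).le, Nat.add_sub_cancel]
    exact h3
  · have h3 := hF.solution_error (hmem n h1 h2)
    have h4 : yδ - F (x n) - F' (x n) (xd - x n)
        = (yδ - y) + (y - F (x n) - F' (x n) (xd - x n)) := by abel
    rw [h4]
    exact (norm_add_le _ _).trans (add_le_add hyδ h3)
  · have h3 := hF.image_error (hmem n h1 h2)
    have h4 : F (x n) - yδ
        = -(yδ - y) + (F (x n) - y - F' xd (x n - xd)) + F' xd (x n - xd) := by abel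
    have h5 := norm_add₃_le (a := -(yδ - y)) (b := F (x n) - y - F' xd (x n - xd))
      (c := F' xd (x n - xd))
    rw [← h4, norm_neg] at h5
    linarith
  · have h3 := hF.image_error (hmem n h1 h2)
    have h4 : F' xd (x n - xd)
        = (F (x n) - yδ) + (yδ - y) + -(F (x n) - y - F' xd (x n - xd)) := by abel
    have h5 := norm_add₃_le (a := F (x n) - yδ) (b := yδ - y)
      (c := -(F (x n) - y - F' xd (x n - xd)))
    rw [← h4, norm_neg] at h5
    linarith
  · have h4 := hF.solution_error (hmem n h1 h2)
    have h5 := hF.cross_error (hmem n h1 h2) (x (n + 1) - xd)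
    have h6 : F' xd (x (n + 1) - xd)
        = -(yδ - F (x n) - F' (x n) (x (n + 1) - x n)) + (yδ - y)
          + (y - F (x n) - F' (x n) (xd - x n))
          + -(F' (x n) (x (n + 1) - xd) - F' xd (x (n + 1) - xd)) := by
      simp only [map_sub]
      abel
    have h7 := norm_add₄_le (a := -(yδ - F (x n) - F' (x n) (x (n + 1) - x n))) (b := yδ - y)
      (c := y - F (x n) - F' (x n) (xd - x n))
      (d := -(F' (x n) (x (n + 1) - xd) - F' xd (x (n + 1) - xd)))
    rw [← h6, norm_neg, norm_neg] at h7
    simp only [Nat.add_sub_cancel]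
    linarith
  · have h0 := hF.image_error (hmem (n + 1) (hstep n h1 h2).1 h3)
    have h4 := hF.solution_error (hmem n h1 h2)
    have h5 := hF.cross_error (hmem n h1 h2) (x (n + 1) - xd)
    have h6 : F (x (n + 1)) - yδ
        = -(yδ - F (x n) - F' (x n) (x (n + 1) - x n))
          + (F (x (n + 1)) - y - F' xd (x (n + 1) - xd))
          + (y - F (x n) - F' (x n) (xd - x n))
          + -(F' (x n) (x (n + 1) - xd) - F' xd (x (n + 1) - xd)) := by
      simp only [map_sub]
      abel
    have h7 := norm_add₄_le (a := -(yδ - F (x n) - F' (x n) (x (n + 1) - x n)))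
      (b := F (x (n + 1)) - y - F' xd (x (n + 1) - xd))
      (c := y - F (x n) - F' (x n) (xd - x n))
      (d := -(F' (x n) (x (n + 1) - xd) - F' xd (x (n + 1) - xd)))
    rw [← h6, norm_neg, norm_neg] at h7
    simp only [Nat.add_sub_cancel]
    linarith

end Iterates

end IRGN

/-! ### Assembly of the theorem. -/

theorem theorem4p1 (p γ θ τ ν : ℝ) (hp : 2 ≤ p) (hγ : 0 < γ) (hθ : 1 < θ) (hτ : 1 < τ)
    (hν₀ : 0 < ν) (hν₁ : ν ≤ 1) :
    ∃ C : ℝ, 0 < C ∧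
    ∀ μ : ℝ, 0 < μ → γ ^ (1 / (p - 1)) * θ ^ (2 / p) * μ⁻¹ < (τ - 1) / 2 →
    ∃ ε : ℝ, 0 < ε ∧
    ∀ (X Y : Type*) [NormedAddCommGroup X] [NormedSpace ℝ X] [CompleteSpace X]
      [NormedAddCommGroup Y] [NormedSpace ℝ Y] [CompleteSpace Y]
      (Θ : X → EReal) (DF : Set X) (F : X → Y) (F' : X → X →L[ℝ] Y) (α : ℕ → ℝ)
      (y : Y) (xd : X) (ρ K₀ K₁ : ℝ) (ξ₀ ξd : StrongDual ℝ X) (x₀ : X) (β : ℝ),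
      IRGN.IsProper Θ → LowerSemicontinuous Θ → IRGN.IsPConvex p Θ → IRGN.PConvexBound p γ Θ →
      IRGN.IsParamSeq θ α →
      IRGN.OperatorAssumption p γ Θ (α 0) DF F y xd ρ F' K₀ K₁ →
      -- the initial guess `x₀ = ∇Θ_F^*(ξ₀)`
      IRGN.IsDualGradientAt (IRGN.fenchelConj (IRGN.restrictTo Θ DF)) ξ₀ x₀ →
      -- `ξd` realizes the distance from `ξ₀` to `∂Θ_F(xd)`
      ξd ∈ IRGN.subdiff (IRGN.restrictTo Θ DF) xd →
      Metric.infDist ξ₀ (IRGN.subdiff (IRGN.restrictTo Θ DF) xd) = ‖ξ₀ - ξd‖ →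
      -- closeness and smallness conditions
      (p / (p - 1) * γ * μ + 2 * γ ^ (p / (p - 1))) * ‖ξ₀ - ξd‖ ^ (1 / (p - 1)) < ρ →
      (K₀ + K₁) * ‖ξ₀ - ξd‖ ^ (1 / (p - 1)) ≤ ε →
      0 ≤ β →
      IRGN.SourceCondition p ν β (IRGN.restrictTo Θ DF) ξ₀ ξd xd (F' xd) →
      ∀ (δ : ℝ) (yδ : Y) (x : ℕ → X), 0 < δ → ‖yδ - y‖ ≤ δ →
      IRGN.IsIRGN p (IRGN.restrictTo Θ DF) DF F xd ρ F' α yδ ξ₀ x₀ x →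
      (∃! n, IRGN.AverageRule τ δ (fun k => ‖F (x k) - yδ‖) n) ∧
      (∃! n, IRGN.MaxRule τ δ (fun k => ‖F (x k) - yδ‖) n) ∧
      ∀ n, (IRGN.AverageRule τ δ (fun k => ‖F (x k) - yδ‖) n ∨
            IRGN.MaxRule τ δ (fun k => ‖F (x k) - yδ‖) n) →
        IRGN.bregman (IRGN.restrictTo Θ DF) ξd (x n) xd
            ≤ ((C * β ^ (p / (p - 1 + ν)) * δ ^ (p * ν / (p - 1 + ν)) : ℝ) : EReal) ∧
        ‖x n - xd‖ ≤ C * β ^ (1 / (p - 1 + ν)) * δ ^ (ν / (p - 1 + ν)) := by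
  have hp0 : 0 < p := by linarith
  have hp1 : 0 < p - 1 := by linarith
  have hq : 0 < p - 1 + ν := by linarith
  have hθ0 : 0 < θ := by linarith
  have hϑ : 1 ≤ θ ^ (1 / p) := Real.one_le_rpow hθ.le (by positivity)
  obtain ⟨η, C, hη, hC, hrate⟩ :=
    IRGN.IterationEstimates.exists_rate (p := p) (γ := γ) hp hγ hϑ hτ hν₀ hν₁
  -- The two entries serve the Bregman distance, a `p`-th power, and the norm. Neither depends on μ:
  -- the rate needs only closeness η, and μ enters through the ε that guarantees it.
  refine ⟨max (C ^ p) (γ * C), lt_max_of_lt_left (Real.rpow_pos_of_pos hC p), ?_⟩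
  intro μ hμ hμτ
  have hϑ2 : (θ ^ (1 / p)) ^ 2 = θ ^ (2 / p) := by
    rw [← Real.rpow_natCast, ← Real.rpow_mul hθ0.le]
    congr 1
    push_cast
    ring
  obtain ⟨ε, hε, hindex⟩ := IRGN.IterationEstimates.exists_index_discrepancy_le
    (g := γ ^ (1 / (p - 1))) (ϑ := θ ^ (1 / p)) hp hγ (Real.rpow_pos_of_pos hγ _) hμ hϑ
    (by rw [hϑ2]; exact hμτ) hη
  refine ⟨ε, hε, ?_⟩
  intro X Y _ _ _ _ _ _ Θ DF F F' α y xd ρ K₀ K₁ ξ₀ ξd x₀ β hΘ hlsc hconv hbound hα hF hx₀ hξd _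
    hρ hKε hβ hsource δ yδ x hδ hyδ hx
  have hest := hx.iterationEstimates hp hγ hΘ hlsc hconv hbound hα.1 hF hx₀ hξd hsource hyδ
  have hγg : γ * γ ^ (1 / (p - 1)) = γ ^ (p / (p - 1)) := by
    rw [mul_comm, ← Real.rpow_add_one hγ.ne']
    congr 1
    field_simp
    ring
  have hapos : ∀ n, 0 < α n ^ (1 / p) := fun n => Real.rpow_pos_of_pos (hα.1 n) _
  have hanti : ∀ n, α (n + 1) ^ (1 / p) ≤ α n ^ (1 / p) := fun n => by
    have h1 := (hα.2.1 n).1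
    rw [one_le_div (hα.1 _)] at h1
    exact Real.rpow_le_rpow (hα.1 _).le h1 (by positivity)
  have haϑ : ∀ n, α n ^ (1 / p) ≤ θ ^ (1 / p) * α (n + 1) ^ (1 / p) := fun n => by
    have h1 := (hα.2.1 n).2
    rw [div_le_iff₀ (hα.1 _)] at h1
    rw [← Real.mul_rpow hθ0.le (hα.1 _).le]
    exact Real.rpow_le_rpow (hα.1 _).le h1 (by positivity)
  have hlim : Tendsto (fun n => α n ^ (1 / p)) atTop (𝓝 0) := by
    have := hα.2.2.rpow_const (p := 1 / p) (Or.inr (by positivity))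
    rwa [Real.zero_rpow (by positivity)] at this
  obtain ⟨k, hk, hsmall⟩ := hindex ν (‖ξ₀ - ξd‖ ^ (1 / (p - 1))) K₀ K₁ β ρ δ _ _ _ _ _ _ _ _ _ hest
    (by positivity) hF.K₀_nonneg hF.K₁_nonneg hδ hapos hanti haϑ hlim (by rwa [hγg]) hKε
  refine ⟨IRGN.existsUnique_averageRule hsmall, IRGN.existsUnique_maxRule hsmall, fun n hn => ?_⟩
  obtain ⟨hrate₀, hrate₁⟩ := hrate _ K₀ K₁ β ρ δ _ _ _ _ _ _ _ _ _ k hest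
    hF.K₀_nonneg hF.K₁_nonneg hβ hδ hapos haϑ hk
  set Z := β ^ (1 / (p - 1 + ν)) * δ ^ (ν / (p - 1 + ν)) with hZ
  have hZ0 : 0 ≤ Z := by positivity
  have hmain : x n ∈ IRGN.effDomain (IRGN.restrictTo Θ DF) ∧
      (IRGN.bregman (IRGN.restrictTo Θ DF) ξd (x n) xd).toReal ^ (1 / p) ≤ C * Z := by
    rcases IRGN.stopping_cases (by positivity) (fun n => norm_nonneg _) hsmall hn with
      ⟨h0, rfl⟩ | ⟨m, rfl, hmk, hj, hr, hr'⟩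
    · exact ⟨(hk 0 (Nat.zero_le _)).1, hrate₀ h0⟩
    · exact ⟨(hk _ hmk).1, hrate₁ m hmk hj hr hr'⟩
  obtain ⟨hdom, hd⟩ := hmain
  have hbot := IRGN.restrictTo_ne_bot hΘ.1 DF
  have hxd : xd ∈ IRGN.effDomain (IRGN.restrictTo Θ DF) := by
    rw [IRGN.effDomain_restrictTo hΘ.1]
    exact ⟨hF.sol_mem_subdiffDomain.1, hF.sol_mem_domain⟩
  constructor
  · have h1 := IRGN.bregman_eq_coe hbot hxd hdom ξd
    have h2 : 0 ≤ (IRGN.bregman (IRGN.restrictTo Θ DF) ξd (x n) xd).toReal :=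
      EReal.toReal_nonneg (hξd _)
    have h3 : (IRGN.bregman (IRGN.restrictTo Θ DF) ξd (x n) xd).toReal ≤ C ^ p * Z ^ p := by
      have := Real.rpow_le_rpow (Real.rpow_nonneg h2 _) hd hp0.le
      rwa [← Real.rpow_mul h2, one_div_mul_cancel hp0.ne', Real.rpow_one,
        Real.mul_rpow hC.le hZ0] at this
    have h4 : Z ^ p = β ^ (p / (p - 1 + ν)) * δ ^ (p * ν / (p - 1 + ν)) := by
      rw [hZ, Real.mul_rpow (by positivity) (by positivity), ← Real.rpow_mul hβ,
        ← Real.rpow_mul hδ.le]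
      congr 2 <;> ring
    rw [h1, EReal.toReal_coe] at h3
    rw [h1, EReal.coe_le_coe_iff, mul_assoc, ← h4]
    refine h3.trans ?_
    have := Real.rpow_nonneg hZ0 p
    gcongr
    exact le_max_left _ _
  · have h1 := hest.dist_le n hdom
    rw [mul_assoc, ← hZ]
    calc ‖x n - xd‖ ≤ γ * (C * Z) := h1.trans (by gcongr)
      _ = γ * C * Z := by ring
      _ ≤ max (C ^ p) (γ * C) * Z := by
          gcongr
          exact le_max_right _ _
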